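/- An instance of MEFE-Matching consists of a finite set $X$ of courses, a finite set $T$ of TAs, utilities $u_t(x)\in\mathbb Z_{\ge 0}$ and grades $g_t(x)\in\mathbb Q_{\ge 0}$ of every TA $t$ for (respectively, in) every course $x$, utilities $v_x(t)\in\mathbb Z_{\ge 0}$ of every course $x$ for every TA $t$ with $v_x(t)=0$ if and only if $u_t(x)=0$, a capacity $c_x\in\mathbb Z_{\ge 1}$ of every course $x$, and a threshold $k\in\mathbb Q_{\ge 0}$. The degree $d(x)$ of a course $x$ is the number of TAs $t$ with $v_x(t)>0$. A matching is a map $\mu\colon T\to X\cup\{\emptyset\}$, where $u_t(\emptyset)=0$. It is an MEFE (merit-based envy-free egalitarian) matching if (i) $|\mu^{-1}(x)|=c_x$ for every course $x$, and $u_t(\mu(t))>0$ whenever $\mu(t)\neq\emptyset$; (ii) $\frac{1}{c_x}\sum_{t\in\mu^{-1}(x)}v_x(t)\ge k$ for every course $x$; (iii) there are no TAs $t,t'$ with $\mu(t')=x\in X$, $g_t(x)\ge g_{t'}(x)$ and $u_t(x)>u_t(\mu(t))$. MEFE-Matching asks, given an instance (all numbers written in binary, rationals as fractions), to output an MEFE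 matching, or to report that none exists. Theorem. MEFE-Matching can be solved in polynomial time on the instances with $d(x)-c_x\le 1$ for every course $x$. Corollary. MEFE-Matching can be solved in polynomial time on the instances with $d(x)\le 2$ for every course $x$. -/

import Mathlib

/-! ## A random access machine with a step count

A machine has arrays `0, 1, 2, …` of natural numbers, each with cells `0, 1, 2, …`. A program is a
structured (while) program; the array names and the constants in it are fixed, so that a program
uses finitely many arrays, while the cell index is computed (indirect addressing). The arithmetic
operations are addition, truncated subtraction and halving, each of unit cost; there is no
multiplication, so that one step lengthens numbers by at most one bit and the number of steps is
polynomially related to the running time of a Turing machine. -/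

namespace RAM

/-- The contents of the memory: `s a i` is cell `i` of array `a`. -/
abbrev State : Type := ℕ → ℕ → ℕ

/-- Arithmetic expressions. -/
inductive Term : Type
  | const (n : ℕ)
  | load (a : ℕ) (i : Term)
  | add (e₁ e₂ : Term)
  | sub (e₁ e₂ : Term)
  | half (e : Term)

/-- The value of an expression (`sub` is truncated at `0`, `half` rounds down). -/
def Term.eval (s : State) : Term → ℕ
  | .const n => n
  | .load a i => s a (i.eval s)
  | .add e₁ e₂ => e₁.eval s + e₂.eval s
  | .sub e₁ e₂ => e₁.eval s - e₂.eval s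
  | .half e => e.eval s / 2

/-- The number of steps needed to evaluate an expression: one for each operation in it. -/
def Term.cost : Term → ℕ
  | .const _ => 1
  | .load _ i => i.cost + 1
  | .add e₁ e₂ => e₁.cost + e₂.cost + 1
  | .sub e₁ e₂ => e₁.cost + e₂.cost + 1
  | .half e => e.cost + 1

/-- Programs. -/
inductive Prog : Type
  | nop
  | store (a : ℕ) (i e : Term)
  | seq (p q : Prog)
  | cond (e : Term) (p q : Prog)
  | loop (e : Term) (p : Prog)

/-- The memory after writing `n` into cell `i` of array `a`. -/
def State.write (s : State) (a i n : ℕ) : State :=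
  fun b j => if b = a ∧ j = i then n else s b j

/-- `Exec p s k s'`: the program `p`, started with memory `s`, halts after exactly `k` steps with
memory `s'`. A condition `e` is true if its value is nonzero. -/
inductive Exec : Prog → State → ℕ → State → Prop
  | nop (s : State) : Exec .nop s 1 s
  | store (s : State) (a : ℕ) (i e : Term) :
      Exec (.store a i e) s (i.cost + e.cost + 1) (s.write a (i.eval s) (e.eval s))
  | seq {p q : Prog} {s s' s'' : State} {k l : ℕ} :
      Exec p s k s' → Exec q s' l s'' → Exec (.seq p q) s (k + l) s''
  | cond_true {e : Term} {p q : Prog} {s s' : State} {k : ℕ} :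
      e.eval s ≠ 0 → Exec p s k s' → Exec (.cond e p q) s (e.cost + 1 + k) s'
  | cond_false {e : Term} {p q : Prog} {s s' : State} {k : ℕ} :
      e.eval s = 0 → Exec q s k s' → Exec (.cond e p q) s (e.cost + 1 + k) s'
  | loop_true {e : Term} {p : Prog} {s s' s'' : State} {k l : ℕ} :
      e.eval s ≠ 0 → Exec p s k s' → Exec (.loop e p) s' l s'' →
        Exec (.loop e p) s (e.cost + 1 + k + l) s''
  | loop_false {e : Term} {p : Prog} {s : State} :
      e.eval s = 0 → Exec (.loop e p) s (e.cost + 1) s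

/-- The initial memory: the input is in array `0`, and all other cells are `0`. -/
def initial (input : List ℕ) : State :=
  fun a i => if a = 0 then input.getD i 0 else 0

/-- The length of an input: its numbers are written in binary, with one separator after each. -/
def inputLength (input : List ℕ) : ℕ := (input.map fun n => n.size + 1).sum

/-- The problem with instances `i : ι`, restricted to those with `dom i`, is solvable in polynomial
time: one program halts on the encoding of each such instance, within a number of steps that is
polynomial in the length of the encoding, and leaves a correct answer in array `1`. -/
def SolvableInPolyTime {ι : Type} (dom : ι → Prop) (encode : ι → List ℕ)
    (correct : ι → (ℕ → ℕ) → Prop) : Prop :=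
  ∃ (p : Prog) (b : Polynomial ℕ), ∀ i : ι, dom i →
    ∃ (k : ℕ) (s : State), Exec p (initial (encode i)) k s ∧
      k ≤ b.eval (inputLength (encode i)) ∧ correct i (s 1)

end RAM

/-! ## Merit-based envy-free egalitarian matchings -/

namespace MEFE

/-- An instance with `n` courses and `m` TAs. -/
structure Instance where
  /-- the number of courses -/
  n : ℕ
  /-- the number of TAs -/
  m : ℕ
  /-- `u t x`: the utility of TA `t` for course `x` -/
  u : Fin m → Fin n → ℕ
  /-- `g t x`: the grade of TA `t` in course `x` -/
  g : Fin m → Fin n → NNRat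
  /-- `v x t`: the utility of course `x` for TA `t` -/
  v : Fin n → Fin m → ℕ
  /-- the capacity of a course -/
  cap : Fin n → ℕ
  /-- the satisfaction threshold -/
  k : NNRat
  cap_pos : ∀ x, 0 < cap x
  /-- a course values exactly those TAs positively that value it positively -/
  v_eq_zero_iff : ∀ x t, v x t = 0 ↔ u t x = 0

namespace Instance

variable (I : Instance)

/-- The degree of a course: the number of TAs that it values positively. -/
def degree (x : Fin I.n) : ℕ := (Finset.univ.filter fun t => 0 < I.v x t).card

/-- A matching sends each TA to a course, or to `none` if the TA is unassigned. -/
abbrev Matching : Type := Fin I.m → Option (Fin I.n)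

variable {I}

/-- The TAs assigned to a course. -/
def Matching.assigned (μ : I.Matching) (x : Fin I.n) : Finset (Fin I.m) :=
  Finset.univ.filter fun t => μ t = some x

/-- Every course gets as many TAs as its capacity, and no TA gets a course that it values `0`. -/
def Matching.IsFeasible (μ : I.Matching) : Prop :=
  (∀ x, (μ.assigned x).card = I.cap x) ∧ ∀ t x, μ t = some x → I.u t x ≠ 0

/-- The average utility of a course for the TAs assigned to it. -/
def Matching.avgUtil (μ : I.Matching) (x : Fin I.n) : ℚ :=
  (∑ t ∈ μ.assigned x, (I.v x t : ℚ)) / (I.cap x : ℚ)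

/-- The utility of a TA for its own assignment, which is `0` if the TA is unassigned. -/
def Matching.utility (μ : I.Matching) (t : Fin I.m) : ℕ := (μ t).elim 0 (I.u t)

/-- TA `t` envies TA `t'` on merit basis (nobody envies an unassigned TA). -/
def Matching.Envies (μ : I.Matching) (t t' : Fin I.m) : Prop :=
  ∃ x, μ t' = some x ∧ I.g t' x ≤ I.g t x ∧ μ.utility t < I.u t x

/-- Merit-based envy-free egalitarian matchings. -/
def Matching.IsMEFE (μ : I.Matching) : Prop :=
  μ.IsFeasible ∧ (∀ x, (I.k : ℚ) ≤ μ.avgUtil x) ∧ ∀ t t', ¬ μ.Envies t t'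

variable (I)

/-- The encoding of an instance as a list of numbers: the sizes `n` and `m`, the threshold as a
reduced fraction, the capacities, and then, TA by TA and course by course, the two utilities and
the grade as a reduced fraction. -/
def encode : List ℕ :=
  [I.n, I.m, I.k.num, I.k.den] ++ List.ofFn I.cap ++
    (List.finRange I.m).flatMap fun t => (List.finRange I.n).flatMap fun x =>
      [I.u t x, I.v x t, (I.g t x).num, (I.g t x).den]

/-- The code of the assignment of a TA: `0` if it is unassigned and `x + 1` if it gets course `x`
(courses are numbered from `0`). -/
def code : Option (Fin I.n) → ℕ
  | none => 0
  | some x => (x : ℕ) + 1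

/-- The correct answers: either `1`, followed by the codes of the assignments of all TAs in an MEFE
matching, or `0` if there is no such matching. -/
def CorrectAnswer (out : ℕ → ℕ) : Prop :=
  (out 0 = 1 ∧ ∃ μ : I.Matching, μ.IsMEFE ∧ ∀ t : Fin I.m, out ((t : ℕ) + 1) = I.code (μ t)) ∨
  (out 0 = 0 ∧ ¬ ∃ μ : I.Matching, μ.IsMEFE)

end Instance

end MEFE

/-! Take the courses and TAs as the vertices of a bipartite graph, with an edge where the utility is
positive. If d(x) ≤ c_x + 1, a course drops at most one neighbour. A feasible matching then gives
every edge to exactly one of its ends, each vertex owning at most one edge: a TA owns the edge to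
its course, and a course owns the edge to the TA that it drops. Capacity and threshold become a
condition on what a single course owns. Envy also becomes local: if `t` prefers a neighbour `x` to
its own assignment, then `t` is the TA that `x` drops, all other neighbours of `x` are assigned to
`x`, and freedom from envy says that the grade of `t` in `x` is below all of theirs. So MEFE
matchings amount to ownership functions satisfying `IsSol` (`Matching.IsMEFE.isSol`,
`exists_isMEFE_of_isSol`).

Following owned edges gives a functional graph, in which every vertex reaches a fixed point or a
cycle. If `r` is recurrent, the set of vertices that reach `r` is closed under adjacency
(`Reaches.adj`), and the choice at `r` forces all choices there: an edge not owned by an end whose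
choice is known is owned by the other end. Hence it suffices to try each vertex with each choice,
propagate, and check the outcome. Consistent outcomes live on unions of components and can be glued
(`Good.merge`). If a solution exists, the trials fill every vertex (`Cmd.solve_run`); conversely, a
completely filled table is a solution (`Good.isSol`).

For the running time, the algorithm is written in a language whose loops have ranges bounded in
terms of the number of vertices and whose products have an input cell as left factor. Compiled
programs therefore run in polynomial time by structural induction (`Expr.runs_compile`,
`Cmd.runs_compile`). -/

namespace RAM

/-! ## Rules for bounded execution -/

/-- The program `p`, started with memory `s`, halts within `B` steps with a memory in `Q`. -/
def Runs (p : Prog) (s : State) (B : ℕ) (Q : State → Prop) : Prop :=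
  ∃ (k : ℕ) (s' : State), Exec p s k s' ∧ k ≤ B ∧ Q s'

theorem Runs.mono {p : Prog} {s : State} {B B' : ℕ} {Q Q' : State → Prop}
    (h : Runs p s B Q) (hB : B ≤ B') (hQ : ∀ s', Q s' → Q' s') : Runs p s B' Q' := by
  obtain ⟨k, s', h1, h2, h3⟩ := h
  exact ⟨k, s', h1, h2.trans hB, hQ _ h3⟩

theorem Runs.nop {s : State} {Q : State → Prop} (h : Q s) : Runs .nop s 1 Q :=
  ⟨1, s, .nop s, le_rfl, h⟩

theorem Runs.store {s : State} {a : ℕ} {i e : Term} {Q : State → Prop}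
    (h : Q (s.write a (i.eval s) (e.eval s))) :
    Runs (.store a i e) s (i.cost + e.cost + 1) Q :=
  ⟨_, _, .store s a i e, le_rfl, h⟩

theorem Runs.seq {p q : Prog} {s : State} {A B : ℕ} {Q R : State → Prop}
    (hp : Runs p s A Q) (hq : ∀ s', Q s' → Runs q s' B R) : Runs (.seq p q) s (A + B) R := by
  obtain ⟨k, s', h1, h2, h3⟩ := hp
  obtain ⟨l, s'', h4, h5, h6⟩ := hq s' h3
  exact ⟨k + l, s'', .seq h1 h4, by omega, h6⟩

theorem Runs.cond {e : Term} {p q : Prog} {s : State} {A B : ℕ} {Q : State → Prop}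
    (hp : e.eval s ≠ 0 → Runs p s A Q) (hq : e.eval s = 0 → Runs q s B Q) :
    Runs (.cond e p q) s (e.cost + 1 + (A + B)) Q := by
  by_cases h : e.eval s = 0
  · obtain ⟨k, s', h1, h2, h3⟩ := hq h
    exact ⟨_, s', .cond_false h h1, by omega, h3⟩
  · obtain ⟨k, s', h1, h2, h3⟩ := hp h
    exact ⟨_, s', .cond_true h h1, by omega, h3⟩

/-- A loop that makes exactly `m` further rounds. -/
theorem Runs.loop_aux {e : Term} {p : Prog} {B N : ℕ} (I : ℕ → State → Prop)
    (hne : ∀ i s, i < N → I i s → e.eval s ≠ 0) (heq : ∀ s, I N s → e.eval s = 0)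
    (hp : ∀ i s, i < N → I i s → Runs p s B (I (i + 1))) :
    ∀ m i s, i + m = N → I i s →
      Runs (.loop e p) s (m * (e.cost + 1 + B) + (e.cost + 1)) (I N) := by
  intro m
  induction m with
  | zero =>
    intro i s hi h
    obtain rfl : i = N := by omega
    exact ⟨_, s, .loop_false (heq s h), by omega, h⟩
  | succ m ih =>
    intro i s hi h
    obtain ⟨k, s', h1, h2, h3⟩ := hp i s (by omega) h
    obtain ⟨l, s'', h4, h5, h6⟩ := ih (i + 1) s' (by omega) h3
    refine ⟨_, s'', .loop_true (hne i s (by omega) h) h1 h4, ?_, h6⟩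
    rw [Nat.succ_mul]
    omega

theorem Runs.loop {e : Term} {p : Prog} {B N : ℕ} {s : State} (I : ℕ → State → Prop)
    (hne : ∀ i s, i < N → I i s → e.eval s ≠ 0) (heq : ∀ s, I N s → e.eval s = 0)
    (hp : ∀ i s, i < N → I i s → Runs p s B (I (i + 1))) (h0 : I 0 s) :
    Runs (.loop e p) s (N * (e.cost + 1 + B) + (e.cost + 1)) (I N) :=
  Runs.loop_aux I hne heq hp N 0 s (by omega) h0

theorem State.write_self (s : State) (a i n : ℕ) :
    (s.write a i n) a = Function.update (s a) i n := by
  funext j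
  simp [State.write, Function.update_apply]

theorem State.write_of_ne (s : State) {a b : ℕ} (i n : ℕ) (h : b ≠ a) :
    (s.write a i n) b = s b := by
  funext j
  simp [State.write, h]

/-! ## A language with bounded loops

Its programs read the input, and write to four work arrays. All loops run over the courses, the
TAs, or their disjoint union, and the left factor of a product is a cell of the input, so that the
running time is polynomial for syntactic reasons. -/

/-- The arrays to which a program may write. -/
inductive Arr : Type
  | out | trial | ans | flag
  deriving DecidableEq

/-- The array of the machine that holds a work array; arrays `2` and `3` of the machine hold
intermediate results and loop variables. -/
def Arr.idx : Arr → ℕ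
  | .out => 1
  | .trial => 4
  | .ans => 5
  | .flag => 6

theorem Arr.idx_ne (a : Arr) : a.idx ≠ 0 ∧ a.idx ≠ 2 ∧ a.idx ≠ 3 := by
  cases a <;> simp [Arr.idx]

theorem Arr.idx_injective : Function.Injective Arr.idx := by
  intro a b h
  cases a <;> cases b <;> simp_all [Arr.idx]

/-- The ranges of loops: the first two input cells, their sum, and the successor of the sum. -/
inductive Bound : Type
  | left | right | both | succ

def Bound.val (inp : ℕ → ℕ) : Bound → ℕ
  | .left => inp 0
  | .right => inp 1
  | .both => inp 0 + inp 1
  | .succ => inp 0 + inp 1 + 1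

def Bound.term : Bound → Term
  | .left => .load 0 (.const 0)
  | .right => .load 0 (.const 1)
  | .both => .add (.load 0 (.const 0)) (.load 0 (.const 1))
  | .succ => .add (.add (.load 0 (.const 0)) (.load 0 (.const 1))) (.const 1)

theorem Bound.eval_term (b : Bound) (s : State) : b.term.eval s = b.val (s 0) := by
  cases b <;> rfl

theorem Bound.cost_term_le (b : Bound) : b.term.cost ≤ 7 := by
  cases b <;> simp [Bound.term, Term.cost]

/-- Expressions: `mul i e` is the product of the input cell `i` and `e`, and `sum k b e` is the sum
of `e` over the values of the variable `k` in the range `b`. -/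
inductive Expr : Type
  | lit (n : ℕ)
  | var (k : ℕ)
  | inp (i : Expr)
  | mem (a : Arr) (i : Expr)
  | add (e₁ e₂ : Expr)
  | sub (e₁ e₂ : Expr)
  | mul (i e : Expr)
  | ite (e e₁ e₂ : Expr)
  | sum (k : ℕ) (b : Bound) (e : Expr)

/-- The value of an expression for the input `inp`, the work memory `M` and the values `ρ` of the
variables. -/
def Expr.eval (inp : ℕ → ℕ) (M : Arr → ℕ → ℕ) : Expr → (ℕ → ℕ) → ℕ
  | .lit n, _ => n
  | .var k, ρ => ρ k
  | .inp i, ρ => inp (i.eval inp M ρ)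
  | .mem a i, ρ => M a (i.eval inp M ρ)
  | .add e₁ e₂, ρ => e₁.eval inp M ρ + e₂.eval inp M ρ
  | .sub e₁ e₂, ρ => e₁.eval inp M ρ - e₂.eval inp M ρ
  | .mul i e, ρ => inp (i.eval inp M ρ) * e.eval inp M ρ
  | .ite e e₁ e₂, ρ => if e.eval inp M ρ ≠ 0 then e₁.eval inp M ρ else e₂.eval inp M ρ
  | .sum k b e, ρ => ∑ j ∈ Finset.range (b.val inp), e.eval inp M (Function.update ρ k j)

/-- Commands. -/
inductive Cmd : Type
  | store (a : Arr) (i e : Expr)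
  | seq (p q : Cmd)
  | loop (k : ℕ) (b : Bound) (p : Cmd)

/-- The work memory after a sequence of updates indexed by `0, …, j - 1`. -/
def rounds {α : Type} (f : ℕ → α → α) (M : α) : ℕ → α
  | 0 => M
  | j + 1 => f j (rounds f M j)

/-- The work memory after writing `n` into cell `i` of the array `a`. -/
def put (M : Arr → ℕ → ℕ) (a : Arr) (i n : ℕ) : Arr → ℕ → ℕ :=
  Function.update M a (Function.update (M a) i n)

/-- The work memory after a command. -/
def Cmd.run (inp : ℕ → ℕ) : Cmd → (ℕ → ℕ) → (Arr → ℕ → ℕ) → (Arr → ℕ → ℕ)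
  | .store a i e, ρ, M => put M a (i.eval inp M ρ) (e.eval inp M ρ)
  | .seq p q, ρ, M => q.run inp ρ (p.run inp ρ M)
  | .loop k b p, ρ, M => rounds (fun j M => p.run inp (Function.update ρ k j) M) M (b.val inp)

/-! ## Compilation -/

/-- The intermediate result number `d`. -/
def reg (d : ℕ) : Term := .load 2 (.const d)

/-- The program that sets the intermediate result number `d`. -/
def setReg (d : ℕ) (e : Term) : Prog := .store 2 (.const d) e

/-- The loop variable number `k`. -/
def lvar (k : ℕ) : Term := .load 3 (.const k)

/-- The program that sets the loop variable number `k`. -/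
def setVar (k : ℕ) (e : Term) : Prog := .store 3 (.const k) e

/-- One round of binary multiplication. -/
def mulRound (d : ℕ) : Prog :=
  .seq (.cond (.sub (reg d) (.add (.half (reg d)) (.half (reg d))))
      (setReg (d + 2) (.add (reg (d + 2)) (reg (d + 1)))) .nop)
    (.seq (setReg (d + 1) (.add (reg (d + 1)) (reg (d + 1)))) (setReg d (.half (reg d))))

/-- The program that puts the value of an expression into the intermediate result number `d`, and
keeps those with smaller numbers. -/
def Expr.compile : Expr → ℕ → Prog
  | .lit n, d => setReg d (.const n)
  | .var k, d => setReg d (lvar k)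
  | .inp i, d => .seq (i.compile d) (setReg d (.load 0 (reg d)))
  | .mem a i, d => .seq (i.compile d) (setReg d (.load a.idx (reg d)))
  | .add e₁ e₂, d =>
    .seq (e₁.compile d) (.seq (e₂.compile (d + 1)) (setReg d (.add (reg d) (reg (d + 1)))))
  | .sub e₁ e₂, d =>
    .seq (e₁.compile d) (.seq (e₂.compile (d + 1)) (setReg d (.sub (reg d) (reg (d + 1)))))
  | .mul i e, d =>
    .seq (i.compile d) (.seq (e.compile (d + 1)) (.seq (setReg d (.load 0 (reg d)))
      (.seq (setReg (d + 2) (.const 0)) (.seq (.loop (reg d) (mulRound d))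
        (setReg d (reg (d + 2)))))))
  | .ite e e₁ e₂, d => .seq (e.compile d) (.cond (reg d) (e₁.compile d) (e₂.compile d))
  | .sum k b e, d =>
    .seq (setReg d (.const 0)) (.seq (setReg (d + 1) (lvar k)) (.seq (setVar k (.const 0))
      (.seq (.loop (.sub b.term (lvar k))
        (.seq (e.compile (d + 2)) (.seq (setReg d (.add (reg d) (reg (d + 2))))
          (setVar k (.add (lvar k) (.const 1))))))
        (setVar k (reg (d + 1))))))

/-- The program for a command, which keeps the intermediate results with numbers below `d`. -/
def Cmd.compile : Cmd → ℕ → Prog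
  | .store a i e, d =>
    .seq (i.compile d) (.seq (e.compile (d + 1)) (.store a.idx (reg d) (reg (d + 1))))
  | .seq p q, d => .seq (p.compile d) (q.compile d)
  | .loop k b p, d =>
    .seq (setReg d (lvar k)) (.seq (setVar k (.const 0))
      (.seq (.loop (.sub b.term (lvar k))
        (.seq (p.compile (d + 1)) (setVar k (.add (lvar k) (.const 1)))))
        (setVar k (reg d))))

open Polynomial in
/-- A bound for the number of steps of a compiled expression. -/
noncomputable def Expr.steps : Expr → Polynomial ℕ
  | .lit _ => 10
  | .var _ => 10
  | .inp i => i.steps + 10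
  | .mem _ i => i.steps + 10
  | .add e₁ e₂ => e₁.steps + e₂.steps + 10
  | .sub e₁ e₂ => e₁.steps + e₂.steps + 10
  | .mul i e => i.steps + e.steps + X * 60 + 60
  | .ite e e₁ e₂ => e.steps + e₁.steps + e₂.steps + 10
  | .sum _ _ e => X * (e.steps + 60) + 60

open Polynomial in
/-- A bound for the number of steps of a compiled command. -/
noncomputable def Cmd.steps : Cmd → Polynomial ℕ
  | .store _ i e => i.steps + e.steps + 10
  | .seq p q => p.steps + q.steps
  | .loop _ _ p => X * (p.steps + 60) + 60

/-- The memory of the machine represents an input, a work memory and the values of variables. -/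
structure Rep (inp : ℕ → ℕ) (M : Arr → ℕ → ℕ) (ρ : ℕ → ℕ) (s : State) : Prop where
  input : s 0 = inp
  vars : s 3 = ρ
  mem : ∀ a : Arr, s a.idx = M a

/-! ### Correctness and running time of the compiled programs -/

variable {inp : ℕ → ℕ} {M : Arr → ℕ → ℕ} {ρ : ℕ → ℕ} {s : State} {L : ℕ}

theorem Rep.setReg (h : Rep inp M ρ s) (d n : ℕ) : Rep inp M ρ (s.write 2 d n) :=
  ⟨by rw [State.write_of_ne _ _ _ (by decide)]; exact h.input,
    by rw [State.write_of_ne _ _ _ (by decide)]; exact h.vars,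
    fun a => by rw [State.write_of_ne _ _ _ a.idx_ne.2.1]; exact h.mem a⟩

theorem Rep.setVar (h : Rep inp M ρ s) (k n : ℕ) :
    Rep inp M (Function.update ρ k n) (s.write 3 k n) :=
  ⟨by rw [State.write_of_ne _ _ _ (by decide)]; exact h.input,
    by rw [State.write_self, h.vars],
    fun a => by rw [State.write_of_ne _ _ _ a.idx_ne.2.2]; exact h.mem a⟩

theorem Rep.put (h : Rep inp M ρ s) (a : Arr) (i n : ℕ) :
    Rep inp (put M a i n) ρ (s.write a.idx i n) :=
  ⟨by rw [State.write_of_ne _ _ _ a.idx_ne.1.symm]; exact h.input,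
    by rw [State.write_of_ne _ _ _ a.idx_ne.2.2.symm]; exact h.vars,
    fun b => by
      by_cases hb : b = a
      · subst hb
        rw [State.write_self, h.mem, RAM.put, Function.update_self]
      · rw [State.write_of_ne _ _ _ fun hc => hb (Arr.idx_injective hc), h.mem, RAM.put,
          Function.update_of_ne hb]⟩

theorem Runs.setReg {d : ℕ} {e : Term} {Q : State → Prop} (h : Q (s.write 2 d (e.eval s))) :
    Runs (setReg d e) s (e.cost + 2) Q :=
  (Runs.store h).mono (by simp [Term.cost]; omega) fun _ => id

theorem Runs.setVar {k : ℕ} {e : Term} {Q : State → Prop} (h : Q (s.write 3 k (e.eval s))) :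
    Runs (setVar k e) s (e.cost + 2) Q :=
  (Runs.store h).mono (by simp [Term.cost]; omega) fun _ => id

@[simp] theorem eval_reg (d : ℕ) : (reg d).eval s = s 2 d := rfl

@[simp] theorem eval_lvar (k : ℕ) : (lvar k).eval s = s 3 k := rfl

@[simp] theorem cost_reg (d : ℕ) : (reg d).cost = 2 := rfl

@[simp] theorem cost_lvar (k : ℕ) : (lvar k).cost = 2 := rfl

/-- The memory `s'` differs from `s` only in intermediate results from number `d` on, and
represents `inp`, `M` and `ρ`. -/
def Keeps (inp : ℕ → ℕ) (M : Arr → ℕ → ℕ) (ρ : ℕ → ℕ) (d : ℕ) (s s' : State) : Prop :=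
  Rep inp M ρ s' ∧ ∀ j < d, s' 2 j = s 2 j

theorem Keeps.refl (h : Rep inp M ρ s) (d : ℕ) : Keeps inp M ρ d s s := ⟨h, fun _ _ => rfl⟩

theorem Keeps.setReg {s' : State} {d i : ℕ} (h : Keeps inp M ρ d s s') (hi : d ≤ i) (n : ℕ) :
    Keeps inp M ρ d s (s'.write 2 i n) :=
  ⟨h.1.setReg i n, fun j hj => by
    rw [State.write_self, Function.update_of_ne (by omega), h.2 j hj]⟩

theorem Keeps.setVar {s' : State} {d : ℕ} (h : Keeps inp M ρ d s s') (k n : ℕ) :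
    Keeps inp M (Function.update ρ k n) d s (s'.write 3 k n) :=
  ⟨h.1.setVar k n, fun j hj => by
    rw [State.write_of_ne _ _ _ (by decide), h.2 j hj]⟩

theorem Keeps.trans {s' s'' : State} {M' : Arr → ℕ → ℕ} {ρ' : ℕ → ℕ} {d d' : ℕ}
    (h : Keeps inp M ρ d s s') (h' : Keeps inp M' ρ' d' s' s'') (hd : d ≤ d') :
    Keeps inp M' ρ' d s s'' :=
  ⟨h'.1, fun j hj => by rw [h'.2 j (by omega), h.2 j hj]⟩

/-- Shift-and-add multiplication: after `i` rounds the three registers hold the unread bits of `a`,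
the shifted `b`, and the product of `b` with the `i` bits already read. -/
theorem runs_mulRound {d a b i : ℕ} {s₀ : State} (hk : Keeps inp M ρ d s₀ s)
    (h0 : s 2 d = a / 2 ^ i) (h1 : s 2 (d + 1) = b * 2 ^ i)
    (h2 : s 2 (d + 2) = a % 2 ^ i * b) :
    Runs (mulRound d) s 50 fun s' => Keeps inp M ρ d s₀ s' ∧ s' 2 d = a / 2 ^ (i + 1) ∧
      s' 2 (d + 1) = b * 2 ^ (i + 1) ∧ s' 2 (d + 2) = a % 2 ^ (i + 1) * b := by
  -- Bit `i` of `a` decides whether `b * 2 ^ i` joins the accumulator.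
  have hmod : a % 2 ^ (i + 1) = a % 2 ^ i + 2 ^ i * (a / 2 ^ i % 2) := by
    rw [pow_succ, Nat.mod_mul]
  have hdiv : a / 2 ^ (i + 1) = a / 2 ^ i / 2 := by rw [pow_succ, Nat.div_div_eq_div_mul]
  refine Runs.mono (Runs.seq (A := 30) (B := 20) (Q := fun s' => Keeps inp M ρ d s₀ s' ∧
    s' 2 d = a / 2 ^ i ∧ s' 2 (d + 1) = b * 2 ^ i ∧ s' 2 (d + 2) = a % 2 ^ (i + 1) * b) ?_ ?_)
    le_rfl fun _ => id
  · refine Runs.mono (Runs.cond (A := 7) (B := 1) (fun h => ?_) fun h => ?_)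
      (by simp [Term.cost]) fun _ => id
    · refine Runs.mono (Runs.setReg ?_) (by simp [Term.cost]) fun _ => id
      refine ⟨hk.setReg (by omega) _, ?_⟩
      simp only [Term.eval, eval_reg, h0] at h
      have : a / 2 ^ i % 2 = 1 := by omega
      simp only [State.write_self, Term.eval, eval_reg, Function.update_self]
      rw [Function.update_of_ne (by omega), Function.update_of_ne (by omega), hmod, this, h0, h1,
        h2]
      refine ⟨rfl, rfl, by ring⟩
    · refine Runs.nop ⟨hk, h0, h1, ?_⟩
      simp only [Term.eval, eval_reg, h0] at h
      have : a / 2 ^ i % 2 = 0 := by omega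
      rw [h2, hmod, this]
      simp
  · rintro s' ⟨hk', h0', h1', h2'⟩
    refine Runs.mono (Runs.seq (Q := fun s' => Keeps inp M ρ d s₀ s' ∧
      s' 2 d = a / 2 ^ i ∧ s' 2 (d + 1) = b * 2 ^ (i + 1) ∧ s' 2 (d + 2) = a % 2 ^ (i + 1) * b)
      (Runs.setReg ?_) fun s'' h'' => Runs.setReg ?_) (by simp [Term.cost]) fun _ => id
    · refine ⟨hk'.setReg (by omega) _, ?_⟩
      simp only [State.write_self, Term.eval, eval_reg, Function.update_self]
      rw [Function.update_of_ne (by omega), Function.update_of_ne (by omega), h0', h1', h2']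
      refine ⟨rfl, by ring, rfl⟩
    · obtain ⟨hk'', h0'', h1'', h2''⟩ := h''
      refine ⟨hk''.setReg le_rfl _, ?_⟩
      simp only [State.write_self, Term.eval, eval_reg, Function.update_self]
      rw [Function.update_of_ne (by omega), Function.update_of_ne (by omega), h0'', h1'', h2'',
        hdiv]
      exact ⟨rfl, rfl, rfl⟩

/-- Only two things cause repetition: sums, with at most `L` terms by `hB`, and products, with one
round per bit of an input cell, at most `L` by `hS`. Other values may be large, since arithmetic has
unit cost. Registers behave like a stack: a subexpression compiled at `d` leaves those below `d`
intact. -/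
theorem Expr.runs_compile (hB : inp 0 + inp 1 + 1 ≤ L) (hS : ∀ i, (inp i).size ≤ L) (e : Expr) :
    ∀ (d : ℕ) (ρ : ℕ → ℕ) (s : State), Rep inp M ρ s →
      Runs (e.compile d) s (e.steps.eval L) fun s' =>
        Keeps inp M ρ d s s' ∧ s' 2 d = e.eval inp M ρ := by
  have hBv : ∀ b : Bound, b.val inp ≤ L := fun b => by cases b <;> simp only [Bound.val] <;> omega
  induction e with
  | lit n =>
    intro d ρ s h
    exact (Runs.setReg ⟨(Keeps.refl h d).setReg le_rfl _, by
      simp [State.write_self, Term.eval, Expr.eval]⟩).mono (by simp [Expr.steps, Term.cost])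
      fun _ => id
  | var k =>
    intro d ρ s h
    exact (Runs.setReg ⟨(Keeps.refl h d).setReg le_rfl _, by
      simp [State.write_self, Expr.eval, h.vars]⟩).mono
      (by simp [Expr.steps]) fun _ => id
  | inp i ih =>
    intro d ρ s h
    refine ((ih d ρ s h).seq fun s' hs' => Runs.setReg
      ⟨hs'.1.setReg le_rfl _, ?_⟩).mono (by simp [Expr.steps, Term.cost]) fun _ => id
    simp [State.write_self, Term.eval, Expr.eval, hs'.1.1.input, hs'.2]
  | mem a i ih =>
    intro d ρ s h
    refine ((ih d ρ s h).seq fun s' hs' => Runs.setReg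
      ⟨hs'.1.setReg le_rfl _, ?_⟩).mono (by simp [Expr.steps, Term.cost]) fun _ => id
    simp [State.write_self, Term.eval, Expr.eval, hs'.1.1.mem, hs'.2]
  | add e₁ e₂ ih₁ ih₂ =>
    intro d ρ s h
    refine ((ih₁ d ρ s h).seq fun s' hs' => (ih₂ (d + 1) ρ s' hs'.1.1).seq fun s'' hs'' =>
      Runs.setReg ⟨(hs'.1.trans hs''.1 (by omega)).setReg le_rfl _, ?_⟩).mono
      (by simp [Expr.steps, Term.cost]; omega) fun _ => id
    simp [State.write_self, Term.eval, Expr.eval, hs''.2, hs''.1.2 d (by omega), hs'.2]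
  | sub e₁ e₂ ih₁ ih₂ =>
    intro d ρ s h
    refine ((ih₁ d ρ s h).seq fun s' hs' => (ih₂ (d + 1) ρ s' hs'.1.1).seq fun s'' hs'' =>
      Runs.setReg ⟨(hs'.1.trans hs''.1 (by omega)).setReg le_rfl _, ?_⟩).mono
      (by simp [Expr.steps, Term.cost]; omega) fun _ => id
    simp [State.write_self, Term.eval, Expr.eval, hs''.2, hs''.1.2 d (by omega), hs'.2]
  | ite e e₁ e₂ ih ih₁ ih₂ =>
    intro d ρ s h
    refine ((ih d ρ s h).seq fun s' hs' => Runs.cond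
      (fun hc => (ih₁ d ρ s' hs'.1.1).mono le_rfl fun s'' hs'' =>
        ⟨hs'.1.trans hs''.1 le_rfl, ?_⟩)
      (fun hc => (ih₂ d ρ s' hs'.1.1).mono le_rfl fun s'' hs'' =>
        ⟨hs'.1.trans hs''.1 le_rfl, ?_⟩)).mono
      (by simp [Expr.steps]; omega) fun _ => id
    · rw [eval_reg, hs'.2] at hc
      simp [Expr.eval, hc, hs''.2]
    · rw [eval_reg, hs'.2] at hc
      simp [Expr.eval, hc, hs''.2]
  | mul i e ihi ihe =>
    intro d ρ s h
    set a := inp (i.eval inp M ρ) with ha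
    set b := e.eval inp M ρ with hb
    refine Runs.mono (Runs.seq (ihi d ρ s h) fun s₁ h₁ => Runs.seq (ihe (d + 1) ρ s₁ h₁.1.1)
      fun s₂ h₂ => Runs.seq (Q := fun s' => Keeps inp M ρ d s s' ∧ s' 2 d = a ∧
        s' 2 (d + 1) = b) (Runs.setReg ?_) fun s₃ h₃ => Runs.seq (Q := fun s' =>
        Keeps inp M ρ d s s' ∧ s' 2 d = a ∧ s' 2 (d + 1) = b ∧ s' 2 (d + 2) = 0)
        (Runs.setReg ?_) fun s₄ h₄ => Runs.seq (Runs.loop (N := a.size) (B := 50) (fun j s' =>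
          Keeps inp M ρ d s s' ∧ s' 2 d = a / 2 ^ j ∧ s' 2 (d + 1) = b * 2 ^ j ∧
            s' 2 (d + 2) = a % 2 ^ j * b) ?_ ?_ ?_ ?_) fun s₅ h₅ => Runs.setReg ?_) ?_ fun _ => id
    · refine ⟨(h₁.1.trans h₂.1 (by omega)).setReg le_rfl _, ?_⟩
      simp [State.write_self, Term.eval, h₂.2, h₂.1.2 d (by omega), h₁.2, h₂.1.1.input, ha, hb]
    · refine ⟨h₃.1.setReg (by omega) _, ?_⟩
      simp [State.write_self, Term.eval, h₃.2]
    · rintro j s' hj ⟨-, h0, -⟩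
      rw [eval_reg, h0]
      have := Nat.lt_size.1 hj
      exact (Nat.div_pos this (by positivity)).ne'
    · rintro s' ⟨-, h0, -⟩
      rw [eval_reg, h0]
      exact Nat.div_eq_of_lt (Nat.lt_size_self a)
    · rintro j s' - ⟨hk, h0, h1, h2⟩
      exact runs_mulRound hk h0 h1 h2
    · obtain ⟨hk, h0, h1, h2⟩ := h₄
      refine ⟨hk, by simp [h0], by simp [h1], by simp [h2, Nat.mod_one]⟩
    · obtain ⟨hk, h0, h1, h2⟩ := h₅
      refine ⟨hk.setReg le_rfl _, ?_⟩
      simp only [State.write_self, eval_reg, Function.update_self, h2, Expr.eval]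
      rw [Nat.mod_eq_of_lt (Nat.lt_size_self a)]
    -- A round costs 50 steps, and its loop test 3.
    · have : a.size * (2 + 1 + 50) ≤ L * 60 := Nat.mul_le_mul (hS _) (by norm_num)
      simp [Expr.steps, Term.cost]
      omega
  | sum k b e ih =>
    intro d ρ s h
    set N := b.val inp with hN
    refine Runs.mono (Runs.seq (Q := fun s' => Keeps inp M ρ d s s' ∧ s' 2 d = 0)
      (Runs.setReg ?_) fun s₁ h₁ => Runs.seq (Q := fun s' => Keeps inp M ρ d s s' ∧ s' 2 d = 0 ∧
        s' 2 (d + 1) = ρ k) (Runs.setReg ?_) fun s₂ h₂ => Runs.seq (Q := fun s' =>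
        Keeps inp M (Function.update ρ k 0) d s s' ∧ s' 2 d = 0 ∧ s' 2 (d + 1) = ρ k)
        (Runs.setVar ?_) fun s₃ h₃ => Runs.seq (Runs.loop (N := N) (B := e.steps.eval L + 20)
          (fun j s' => Keeps inp M (Function.update ρ k j) d s s' ∧
            s' 2 d = ∑ i ∈ Finset.range j, e.eval inp M (Function.update ρ k i) ∧
            s' 2 (d + 1) = ρ k) ?_ ?_ ?_ ?_) fun s₄ h₄ => Runs.setVar ?_) ?_ fun _ => id
    · exact ⟨(Keeps.refl h d).setReg le_rfl _, by simp [State.write_self, Term.eval]⟩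
    · refine ⟨h₁.1.setReg (by omega) _, ?_⟩
      simp [State.write_self, h₁.2, h₁.1.1.vars]
    · refine ⟨h₂.1.setVar _ _, ?_⟩
      rw [State.write_of_ne _ _ _ (by decide)]
      exact h₂.2
    · rintro j s' hj ⟨hk, -⟩
      simp only [Term.eval, Bound.eval_term, eval_lvar, hk.1.input, hk.1.vars,
        Function.update_self]
      omega
    · rintro s' ⟨hk, -⟩
      simp only [Term.eval, Bound.eval_term, eval_lvar, hk.1.input, hk.1.vars,
        Function.update_self]
      omega
    · rintro j s' hj ⟨hk, h0, h1⟩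
      refine Runs.mono (Runs.seq (ih (d + 2) _ s' hk.1) fun s₅ h₅ => Runs.seq (Q := fun s'' =>
        Keeps inp M (Function.update ρ k j) d s s'' ∧
            s'' 2 d = ∑ i ∈ Finset.range (j + 1), e.eval inp M (Function.update ρ k i) ∧
            s'' 2 (d + 1) = ρ k) (Runs.setReg ?_) fun s₆ h₆ => Runs.setVar ?_) ?_ fun _ => id
      · refine ⟨(hk.trans h₅.1 (by omega)).setReg le_rfl _, ?_⟩
        simp [State.write_self, Term.eval, h₅.2, h₅.1.2 d (by omega),
          h₅.1.2 (d + 1) (by omega), h0, h1, Finset.sum_range_succ]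
      · rw [State.write_of_ne _ _ _ (by decide)]
        refine ⟨?_, h₆.2⟩
        have := h₆.1.setVar k (j + 1)
        rw [Function.update_idem] at this
        simpa [Term.eval, h₆.1.1.vars] using this
      · simp [Term.cost]
    · exact ⟨h₃.1, by simp [h₃.2]⟩
    · rw [State.write_of_ne _ _ _ (by decide)]
      refine ⟨?_, by rw [h₄.2.1, Expr.eval]⟩
      -- The loop variable gets back the value saved in register `d + 1`, so the summation variable
      -- is properly local.
      have := h₄.1.setVar k (ρ k)
      rw [Function.update_idem, Function.update_eq_self] at this
      simpa [h₄.2.2] using this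
    · have h7 := b.cost_term_le
      have h8 : N * (b.term.cost + 2 + 1 + 1 + (e.steps.eval L + 20)) ≤
        L * (e.steps.eval L + 60) := Nat.mul_le_mul (hBv b) (by omega)
      simp [Expr.steps, Term.cost]
      omega

theorem Cmd.runs_compile (hB : inp 0 + inp 1 + 1 ≤ L) (hS : ∀ i, (inp i).size ≤ L) (p : Cmd) :
    ∀ (d : ℕ) (ρ : ℕ → ℕ) (M : Arr → ℕ → ℕ) (s : State), Rep inp M ρ s →
      Runs (p.compile d) s (p.steps.eval L) (Keeps inp (p.run inp ρ M) ρ d s) := by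
  have hBv : ∀ b : Bound, b.val inp ≤ L := fun b => by cases b <;> simp only [Bound.val] <;> omega
  induction p with
  | store a i e =>
    intro d ρ M s h
    refine ((i.runs_compile hB hS d ρ s h).seq fun s' hs' =>
      (e.runs_compile hB hS (d + 1) ρ s' hs'.1.1).seq fun s'' hs'' =>
      Runs.store (a := a.idx) (i := reg d) (e := reg (d + 1)) ?_).mono
      (by simp [Cmd.steps]; omega) fun _ => id
    have hk := hs'.1.trans hs''.1 (by omega)
    rw [eval_reg, eval_reg, hs''.2, hs''.1.2 d (by omega), hs'.2]
    refine ⟨hk.1.put a _ _, fun j hj => ?_⟩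
    rw [State.write_of_ne _ _ _ a.idx_ne.2.1.symm]
    exact hk.2 j hj
  | seq p q ihp ihq =>
    intro d ρ M s h
    exact ((ihp d ρ M s h).seq fun s' hs' => (ihq d ρ _ s' hs'.1).mono le_rfl
      fun s'' hs'' => hs'.trans hs'' le_rfl).mono (by simp [Cmd.steps]) fun _ => id
  | loop k b p ih =>
    intro d ρ M s h
    set N := b.val inp with hN
    set f : ℕ → (Arr → ℕ → ℕ) → (Arr → ℕ → ℕ) :=
      fun j M => p.run inp (Function.update ρ k j) M with hf
    refine Runs.mono (Runs.seq (Q := fun s' => Keeps inp M ρ d s s' ∧ s' 2 d = ρ k)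
        (Runs.setReg ?_) fun s₂ h₂ => Runs.seq (Q := fun s' =>
        Keeps inp M (Function.update ρ k 0) d s s' ∧ s' 2 d = ρ k)
        (Runs.setVar ?_) fun s₃ h₃ => Runs.seq (Runs.loop (N := N) (B := p.steps.eval L + 20)
          (fun j s' => Keeps inp (rounds f M j) (Function.update ρ k j) d s s' ∧
            s' 2 d = ρ k) ?_ ?_ ?_ ?_) fun s₄ h₄ => Runs.setVar ?_) ?_ fun _ => id
    · exact ⟨(Keeps.refl h d).setReg le_rfl _, by simp [State.write_self, h.vars]⟩
    · refine ⟨h₂.1.setVar _ _, ?_⟩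
      rw [State.write_of_ne _ _ _ (by decide)]
      exact h₂.2
    · rintro j s' hj ⟨hk, -⟩
      simp only [Term.eval, Bound.eval_term, eval_lvar, hk.1.input, hk.1.vars,
        Function.update_self]
      omega
    · rintro s' ⟨hk, -⟩
      simp only [Term.eval, Bound.eval_term, eval_lvar, hk.1.input, hk.1.vars,
        Function.update_self]
      omega
    · rintro j s' hj ⟨hk, h0⟩
      refine Runs.mono (Runs.seq (ih (d + 1) _ _ s' hk.1) fun s₅ h₅ => Runs.setVar ?_) ?_
        fun _ => id
      · rw [State.write_of_ne _ _ _ (by decide)]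
        refine ⟨?_, by rw [h₅.2 d (by omega), h0]⟩
        have := (hk.trans h₅ (by omega)).setVar k (j + 1)
        rw [Function.update_idem] at this
        simpa [Term.eval, h₅.1.vars, rounds, hf] using this
      · simp [Term.cost]
    · exact h₃
    · have := h₄.1.setVar k (ρ k)
      rw [Function.update_idem, Function.update_eq_self] at this
      simpa [h₄.2, Cmd.run, ← hf, ← hN] using this
    · have h7 := b.cost_term_le
      have h8 : N * (b.term.cost + 2 + 1 + 1 + (p.steps.eval L + 20)) ≤
        L * (p.steps.eval L + 60) := Nat.mul_le_mul (hBv b) (by omega)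
      simp [Cmd.steps, Term.cost]
      omega

end RAM

namespace RAM

/-! ### Reasoning about work memories and commands -/

theorem put_self (M : Arr → ℕ → ℕ) (a : Arr) (i n j : ℕ) :
    put M a i n a j = if j = i then n else M a j := by
  simp [put, Function.update_apply]

theorem put_of_ne (M : Arr → ℕ → ℕ) {a b : Arr} (i n : ℕ) (h : b ≠ a) : put M a i n b = M b := by
  simp [put, h]

theorem rounds_induction {α : Type} {f : ℕ → α → α} {M : α} {N : ℕ} (I : ℕ → α → Prop)
    (h0 : I 0 M) (hs : ∀ j M, j < N → I j M → I (j + 1) (f j M)) : I N (rounds f M N) := by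
  suffices h : ∀ j ≤ N, I j (rounds f M j) from h N le_rfl
  intro j
  induction j with
  | zero => exact fun _ => h0
  | succ j ih => exact fun hj => hs j _ hj (ih (by omega))

/-- The command does not write to the array `a`. -/
def Cmd.Avoids (a : Arr) : Cmd → Prop
  | .store b _ _ => a ≠ b
  | .seq p q => p.Avoids a ∧ q.Avoids a
  | .loop _ _ p => p.Avoids a

theorem Cmd.Avoids.run_eq {inp : ℕ → ℕ} {a : Arr} {p : Cmd} (h : p.Avoids a) :
    ∀ (ρ : ℕ → ℕ) (M : Arr → ℕ → ℕ), p.run inp ρ M a = M a := by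
  induction p with
  | store b i e => exact fun ρ M => put_of_ne _ _ _ h
  | seq p q ihp ihq => exact fun ρ M => (ihq h.2 ρ _).trans (ihp h.1 ρ M)
  | loop k b p ih =>
    exact fun ρ M => rounds_induction (fun _ (M' : Arr → ℕ → ℕ) => M' a = M a) rfl
      fun j M' _ hM' => (ih h _ M').trans hM'

namespace Expr

/-! ### Truth values -/

/-- An expression is true if its value is nonzero. -/
def Holds (inp : ℕ → ℕ) (M : Arr → ℕ → ℕ) (e : Expr) (ρ : ℕ → ℕ) : Prop := e.eval inp M ρ ≠ 0

/-- Truncation makes this 1 at zero and 0 elsewhere, so `neg`, `le`, `eq` and `all` take only the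
values 0 and 1; the other connectives are determined only up to being nonzero. -/
def neg (e : Expr) : Expr := sub (lit 1) e

def le (a b : Expr) : Expr := neg (sub a b)

def lt (a b : Expr) : Expr := sub b a

def eq (a b : Expr) : Expr := neg (add (sub a b) (sub b a))

def conj (a b : Expr) : Expr := ite a b (lit 0)

def disj (a b : Expr) : Expr := add a b

def all (k : ℕ) (b : Bound) (e : Expr) : Expr := neg (sum k b (neg e))

variable {inp : ℕ → ℕ} {M : Arr → ℕ → ℕ} {ρ : ℕ → ℕ}

@[simp] theorem holds_neg (e : Expr) : (neg e).Holds inp M ρ ↔ ¬ e.Holds inp M ρ := by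
  simp [Holds, neg, eval]
  omega

@[simp] theorem holds_le (a b : Expr) :
    (le a b).Holds inp M ρ ↔ a.eval inp M ρ ≤ b.eval inp M ρ := by
  simp [Holds, le, neg, eval]
  omega

@[simp] theorem holds_lt (a b : Expr) :
    (lt a b).Holds inp M ρ ↔ a.eval inp M ρ < b.eval inp M ρ := by
  simp [Holds, lt, eval]
  omega

@[simp] theorem holds_eq (a b : Expr) :
    (eq a b).Holds inp M ρ ↔ a.eval inp M ρ = b.eval inp M ρ := by
  simp [Holds, eq, neg, eval]
  omega

@[simp] theorem holds_conj (a b : Expr) :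
    (conj a b).Holds inp M ρ ↔ a.Holds inp M ρ ∧ b.Holds inp M ρ := by
  simp [Holds, conj, eval]

@[simp] theorem holds_disj (a b : Expr) :
    (disj a b).Holds inp M ρ ↔ a.Holds inp M ρ ∨ b.Holds inp M ρ := by
  simp [Holds, disj, eval]
  omega

open Classical in
@[simp] theorem holds_ite (e a b : Expr) : (ite e a b).Holds inp M ρ ↔
    if e.Holds inp M ρ then a.Holds inp M ρ else b.Holds inp M ρ := by
  simp only [Holds, eval]
  split_ifs <;> simp_all

@[simp] theorem holds_sum (k : ℕ) (b : Bound) (e : Expr) : (sum k b e).Holds inp M ρ ↔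
    ∃ j < b.val inp, e.Holds inp M (Function.update ρ k j) := by
  simp [Holds, eval]

@[simp] theorem holds_all (k : ℕ) (b : Bound) (e : Expr) : (all k b e).Holds inp M ρ ↔
    ∀ j < b.val inp, e.Holds inp M (Function.update ρ k j) := by
  simp [all]

open Classical in
theorem eval_all (k : ℕ) (b : Bound) (e : Expr) : (all k b e).eval inp M ρ =
    if ∀ j < b.val inp, e.Holds inp M (Function.update ρ k j) then 1 else 0 := by
  have h := holds_all (inp := inp) (M := M) (ρ := ρ) k b e
  have h1 : (all k b e).eval inp M ρ ≤ 1 := by simp [all, neg, eval]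
  split_ifs with hc
  · have := h.2 hc
    simp only [Holds] at this
    omega
  · by_contra h2
    exact hc (h.1 h2)

theorem holds_mem (a : Arr) (e : Expr) :
    (mem a e).Holds inp M ρ ↔ M a (e.eval inp M ρ) ≠ 0 := Iff.rfl

open Classical in
@[simp] theorem eval_ite (e a b : Expr) : (ite e a b).eval inp M ρ =
    if e.Holds inp M ρ then a.eval inp M ρ else b.eval inp M ρ := by
  simp only [eval, Holds]
  congr

@[simp] theorem eval_lit (n : ℕ) : (lit n).eval inp M ρ = n := rfl

@[simp] theorem eval_var (k : ℕ) : (var k).eval inp M ρ = ρ k := rfl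

@[simp] theorem eval_inp (i : Expr) : (Expr.inp i).eval inp M ρ = inp (i.eval inp M ρ) := rfl

@[simp] theorem eval_mem (a : Arr) (i : Expr) : (mem a i).eval inp M ρ = M a (i.eval inp M ρ) := rfl

@[simp] theorem eval_add (a b : Expr) :
    (add a b).eval inp M ρ = a.eval inp M ρ + b.eval inp M ρ := rfl

@[simp] theorem eval_sub (a b : Expr) :
    (sub a b).eval inp M ρ = a.eval inp M ρ - b.eval inp M ρ := rfl

@[simp] theorem eval_mul (i e : Expr) :
    (mul i e).eval inp M ρ = inp (i.eval inp M ρ) * e.eval inp M ρ := rfl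

@[simp] theorem eval_sum (k : ℕ) (b : Bound) (e : Expr) : (sum k b e).eval inp M ρ =
    ∑ j ∈ Finset.range (b.val inp), e.eval inp M (Function.update ρ k j) := rfl

end Expr

/-! ### Local conditions, read from the input

Courses `x < inp 0` are the vertices `x`, and TAs `t < inp 1` are the vertices `inp 0 + t`. -/

section conditions

variable (inp : ℕ → ℕ)

/-- The entry number `j` (utility, utility of the course, numerator and denominator of the grade)
for the TA `t` and the course `x`. -/
def entry (j t x : ℕ) : ℕ := inp (4 + (inp 0 + (4 * (inp 0 * t + x) + j)))

/-- A TA and a course are adjacent if the utility is positive. -/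
def Adj (a b : ℕ) : Prop :=
  if a < inp 0 then inp 0 ≤ b ∧ entry inp 0 (b - inp 0) a ≠ 0
  else b < inp 0 ∧ entry inp 0 (a - inp 0) b ≠ 0

def deg (x : ℕ) : ℕ := ∑ t ∈ Finset.range (inp 1), if entry inp 0 t x ≠ 0 then 1 else 0

def total (x : ℕ) : ℕ := ∑ t ∈ Finset.range (inp 1), entry inp 1 t x

/-- The course `x` may drop nobody (`o = 0`), or the vertex `o - 1`. -/
def CourseOK (x o : ℕ) : Prop :=
  if o ≠ 0 then (inp 0 < o ∧ o ≤ inp 0 + inp 1) ∧ entry inp 0 (o - 1 - inp 0) x ≠ 0 ∧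
    deg inp x = inp (4 + x) + 1 ∧
    inp 2 * inp (4 + x) ≤ inp 3 * (total inp x - entry inp 1 (o - 1 - inp 0) x)
  else deg inp x = inp (4 + x) ∧ inp 2 * inp (4 + x) ≤ inp 3 * total inp x

/-- The grade of the TA `t` in the course `x` is below those of all other neighbours of `x`. -/
def Low (t x : ℕ) : Prop :=
  ∀ t' < inp 1, t' = t ∨ entry inp 0 t' x = 0 ∨
    ¬ entry inp 2 t' x * entry inp 3 t x ≤ entry inp 2 t x * entry inp 3 t' x

/-- The TA `t` may stay unassigned (`o = 0`), or be assigned to the course `o - 1`. -/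
def TaOK (t o : ℕ) : Prop :=
  o ≤ inp 0 ∧ (o = 0 ∨ entry inp 0 t (o - 1) ≠ 0) ∧
    ∀ x < inp 0, entry inp 0 t x ≤ (if o ≠ 0 then entry inp 0 t (o - 1) else 0) ∨ Low inp t x

/-- The vertex `v` may own nothing (`o = 0`), or its edge to the vertex `o - 1`. -/
def OK (v o : ℕ) : Prop := if v < inp 0 then CourseOK inp v o else TaOK inp (v - inp 0) o

/-- `A` is consistent on the vertices where it is nonzero, which form a union of components; the
value is `1` at vertices that own nothing, and `w + 2` at those that own the edge to `w`. -/
def Good (A : ℕ → ℕ) : Prop :=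
  ∀ a < inp 0 + inp 1, A a = 0 ∨ OK inp a (A a - 1) ∧ ∀ b < inp 0 + inp 1,
    Adj inp a b → A b ≠ 0 ∧ (A a = b + 2 ↔ ¬ A b = a + 2)

/-- Every edge is owned by exactly one of its ends. -/
def IsSol (p : ℕ → ℕ) : Prop :=
  ∀ a < inp 0 + inp 1, OK inp a (p a) ∧ ∀ b < inp 0 + inp 1,
    Adj inp a b → (p a = b + 1 ↔ ¬ p b = a + 1)

variable {inp}

theorem Adj.symm {a b : ℕ} (h : Adj inp a b) : Adj inp b a := by
  unfold Adj at *
  split_ifs at * with h1 h2 h2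
  · omega
  · exact ⟨by omega, h.2⟩
  · exact ⟨by omega, h.2⟩
  · omega

/-- Both local conditions demand positive utility along the owned edge, so ownership never refers to
a non-edge. -/
theorem OK.adj {v w : ℕ} (h : OK inp v (w + 1)) :
    w < inp 0 + inp 1 ∧ Adj inp v w := by
  unfold OK at h
  unfold Adj
  split_ifs at * with h1
  · simp only [CourseOK, ne_eq, Nat.add_eq_zero_iff, one_ne_zero, and_false, not_false_eq_true,
      if_true, Nat.add_sub_cancel] at h
    exact ⟨by omega, by omega, h.2.1⟩
  · obtain ⟨h2, h3, -⟩ := h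
    simp only [Nat.add_eq_zero_iff, one_ne_zero, and_false, false_or, Nat.add_sub_cancel] at h3
    exact ⟨by omega, by omega, h3⟩

/-- No edge leaves the support of `T`, since goodness makes supports closed under adjacency. Each
edge thus sees either only values of `T` or only values of `A`. -/
theorem Good.merge {A T B : ℕ → ℕ} (hA : Good inp A) (hT : Good inp T)
    (hB : ∀ a < inp 0 + inp 1, B a = if T a ≠ 0 then T a else A a) : Good inp B := by
  intro a ha
  rw [hB a ha]
  split_ifs with h
  · refine Or.inr ⟨((hT a ha).resolve_left h).1, fun b hb hab => ?_⟩
    have := ((hT a ha).resolve_left h).2 b hb hab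
    rw [hB b hb, if_pos this.1]
    exact this
  · refine (hA a ha).imp id fun h' => ⟨h'.1, fun b hb hab => ?_⟩
    have hTb : ¬ T b ≠ 0 := fun hc => h (((hT b hb).resolve_left hc).2 a ha hab.symm).1
    rw [hB b hb, if_neg hTb]
    exact h'.2 b hb hab

theorem Good.isSol {A : ℕ → ℕ} (hA : Good inp A) (h0 : ∀ a < inp 0 + inp 1, A a ≠ 0) :
    IsSol inp fun a => A a - 1 := by
  intro a ha
  obtain ⟨h1, h2⟩ := (hA a ha).resolve_left (h0 a ha)
  refine ⟨h1, fun b hb hab => ?_⟩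
  have h3 := (h2 b hb hab).2
  have h4 := h0 a ha
  have h5 := h0 b hb
  change A a - 1 = b + 1 ↔ ¬ A b - 1 = a + 1
  omega

end conditions

/-! ### The functional graph of a solution -/

section next

variable {inp : ℕ → ℕ} {p : ℕ → ℕ}

/-- The other end of the edge that a vertex owns, or the vertex itself if it owns nothing. -/
def next (p : ℕ → ℕ) (a : ℕ) : ℕ := if p a = 0 then a else p a - 1

theorem IsSol.next_lt (hp : IsSol inp p) {a : ℕ} (ha : a < inp 0 + inp 1) :
    next p a < inp 0 + inp 1 := by
  unfold next
  split_ifs with h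
  · exact ha
  · obtain ⟨w, hw⟩ := Nat.exists_eq_succ_of_ne_zero h
    have := (hp a ha).1
    rw [hw] at this ⊢
    exact (this.adj).1

theorem IsSol.iterate_next_lt (hp : IsSol inp p) {a : ℕ} (ha : a < inp 0 + inp 1) (j : ℕ) :
    (next p)^[j] a < inp 0 + inp 1 := by
  induction j with
  | zero => exact ha
  | succ j ih =>
    rw [Function.iterate_succ_apply']
    exact hp.next_lt ih

/-- The vertices from which `r` is reached. -/
def Reaches (p : ℕ → ℕ) (r a : ℕ) : Prop := ∃ j, (next p)^[j] a = r

/-- `r` is a fixed point or lies on a cycle. -/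
def Recurrent (p : ℕ → ℕ) (r : ℕ) : Prop := Reaches p r (next p r)

theorem reaches_of_next {r a : ℕ} (h : Reaches p r (next p a)) : Reaches p r a := by
  obtain ⟨j, hj⟩ := h
  exact ⟨j + 1, by rwa [Function.iterate_succ_apply]⟩

/-- Recurrence matters only for `a = r`, where the path to `r` has no first step to drop. -/
theorem Reaches.next {r a : ℕ} (hr : Recurrent p r) (h : Reaches p r a) :
    Reaches p r (next p a) := by
  obtain ⟨_ | j, hj⟩ := h
  · obtain rfl : a = r := hj
    exact hr
  · exact ⟨j, by rwa [Function.iterate_succ_apply] at hj⟩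

theorem next_of_eq {a b : ℕ} (h : p a = b + 1) : RAM.next p a = b := by
  simp [RAM.next, h]

/-- One end owns the edge. If it is `b`, then `b` steps to `a` and on to `r`; if it is `a`, then `b`
is the successor of `a`. So the vertices that reach `r` form a union of components. -/
theorem Reaches.adj (hp : IsSol inp p) {r a b : ℕ} (hr : Recurrent p r) (h : Reaches p r a)
    (ha : a < inp 0 + inp 1) (hb : b < inp 0 + inp 1) (hab : Adj inp a b) : Reaches p r b := by
  by_cases hc : p b = a + 1
  · exact reaches_of_next (by rwa [next_of_eq hc])
  · have := ((hp a ha).2 b hb hab).2 hc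
    simpa [next_of_eq this] using h.next hr

/-- Pigeonhole on the first `inp 0 + inp 1 + 1` points of the orbit. -/
theorem IsSol.exists_collision (hp : IsSol inp p) {a : ℕ} (ha : a < inp 0 + inp 1) :
    ∃ i j, i < j ∧ j ≤ inp 0 + inp 1 ∧ (next p)^[i] a = (next p)^[j] a := by
  have : ∃ x ∈ Finset.range (inp 0 + inp 1 + 1), ∃ y ∈ Finset.range (inp 0 + inp 1 + 1), x ≠ y ∧
      (RAM.next p)^[x] a = (RAM.next p)^[y] a :=
    Finset.exists_ne_map_eq_of_card_lt_of_maps_to (t := Finset.range (inp 0 + inp 1)) (by simp)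
      fun x _ => by simpa using hp.iterate_next_lt ha _
  obtain ⟨x, hx, y, hy, hxy, h⟩ := this
  simp only [Finset.mem_range] at hx hy
  rcases lt_or_gt_of_ne hxy with h' | h'
  · exact ⟨x, y, h', by omega, h⟩
  · exact ⟨y, x, h', by omega, h.symm⟩

theorem IsSol.exists_recurrent (hp : IsSol inp p) {a : ℕ} (ha : a < inp 0 + inp 1) :
    ∃ r < inp 0 + inp 1, Recurrent p r ∧ Reaches p r a := by
  obtain ⟨i, j, hij, -, h⟩ := hp.exists_collision ha
  -- The orbit returns to its `i`-th point after `j - i` steps, one of which is the `next` in the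
  -- definition of `Recurrent`.
  refine ⟨(RAM.next p)^[i] a, hp.iterate_next_lt ha _, ⟨j - i - 1, ?_⟩, i, rfl⟩
  rw [← Function.iterate_succ_apply, ← Function.iterate_add_apply, h]
  congr 1
  omega

/-- The number of rounds after which `r` is reached is bounded by the number of vertices. -/
theorem Reaches.exists_le (hp : IsSol inp p) {r a : ℕ} (ha : a < inp 0 + inp 1)
    (h : Reaches p r a) : ∃ j ≤ inp 0 + inp 1, (RAM.next p)^[j] a = r := by
  classical
  refine ⟨Nat.find h, ?_, Nat.find_spec h⟩
  by_contra! hlt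
  obtain ⟨i, j, hij, hj, hc⟩ := hp.exists_collision ha
  -- Cutting the loop between times `i` and `j` out of a shortest path to `r` would give a shorter
  -- one.
  refine Nat.find_min h (m := Nat.find h - (j - i)) (by omega) ?_
  have h1 : Nat.find h - (j - i) = (Nat.find h - j) + i := by omega
  have h2 : Nat.find h = (Nat.find h - j) + j := by omega
  rw [h1, Function.iterate_add_apply, hc, ← Function.iterate_add_apply, ← h2]
  exact Nat.find_spec h

end next

/-! ### The program -/

namespace Expr

/-- The cell of the input that contains an entry. -/
def entryCell (j : ℕ) (t x : Expr) : Expr :=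
  add (lit 4) (add (inp (lit 0)) (add (add (add (add (mul (lit 0) t) x) (add (mul (lit 0) t) x))
    (add (add (mul (lit 0) t) x) (add (mul (lit 0) t) x))) (lit j)))

def entry (j : ℕ) (t x : Expr) : Expr := inp (entryCell j t x)

def adj (a b : Expr) : Expr :=
  ite (lt a (inp (lit 0)))
    (conj (le (inp (lit 0)) b) (entry 0 (sub b (inp (lit 0))) a))
    (conj (lt b (inp (lit 0))) (entry 0 (sub a (inp (lit 0))) b))

/-- The degree of the course `x`, which may not depend on the variable `5`. -/
def deg (x : Expr) : Expr := sum 5 .right (ite (entry 0 (var 5) x) (lit 1) (lit 0))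

/-- The total utility of the course `x`, which may not depend on the variable `5`. -/
def total (x : Expr) : Expr := sum 5 .right (entry 1 (var 5) x)

/-- The code of what the vertex `var 2` owns. -/
def owned : Expr := sub (mem .trial (var 2)) (lit 1)

def courseOK : Expr :=
  ite owned
    (conj (conj (lt (inp (lit 0)) owned) (le owned (add (inp (lit 0)) (inp (lit 1)))))
      (conj (entry 0 (sub (sub owned (lit 1)) (inp (lit 0))) (var 2))
        (conj (eq (deg (var 2)) (add (inp (add (lit 4) (var 2))) (lit 1)))
          (le (mul (lit 2) (inp (add (lit 4) (var 2)))) (mul (lit 3) (sub (total (var 2))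
            (entry 1 (sub (sub owned (lit 1)) (inp (lit 0))) (var 2))))))))
    (conj (eq (deg (var 2)) (inp (add (lit 4) (var 2))))
      (le (mul (lit 2) (inp (add (lit 4) (var 2)))) (mul (lit 3) (total (var 2)))))

/-- The TA number of the vertex `var 2`. -/
def ta : Expr := sub (var 2) (inp (lit 0))

/-- Grades are compared by cross multiplication. The numerators are passed as cell numbers because
the left factor of `mul` must be an input cell. -/
def low : Expr :=
  all 5 .right (disj (eq (var 5) ta) (disj (neg (entry 0 (var 5) (var 6)))
    (neg (le (mul (entryCell 2 (var 5) (var 6)) (entry 3 ta (var 6)))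
      (mul (entryCell 2 ta (var 6)) (entry 3 (var 5) (var 6)))))))

def taOK : Expr :=
  conj (le owned (inp (lit 0))) (conj (disj (eq owned (lit 0)) (entry 0 ta (sub owned (lit 1))))
    (all 6 .left (disj
      (le (entry 0 ta (var 6)) (ite owned (entry 0 ta (sub owned (lit 1))) (lit 0))) low)))

def ok : Expr := ite (lt (var 2) (inp (lit 0))) courseOK taOK

/-- The innermost `eq` compares two truth values that are 0 or 1 as numbers, which expresses that
exactly one end owns the edge. -/
def good : Expr :=
  all 2 .both (disj (eq (mem .trial (var 2)) (lit 0)) (conj ok (all 3 .both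
    (disj (neg (adj (var 2) (var 3))) (conj (mem .trial (var 3))
      (eq (neg (eq (mem .trial (var 2)) (add (var 3) (lit 2))))
        (eq (mem .trial (var 3)) (add (var 2) (lit 2)))))))))

/-! ### The expressions compute the local conditions -/

variable {inp : ℕ → ℕ} {M : Arr → ℕ → ℕ} {ρ : ℕ → ℕ}

theorem eval_entryCell (j : ℕ) (t x : Expr) : (entryCell j t x).eval inp M ρ =
    4 + (inp 0 + (4 * (inp 0 * t.eval inp M ρ + x.eval inp M ρ) + j)) := by
  simp only [entryCell, eval]
  ring

theorem eval_entry (j : ℕ) (t x : Expr) : (entry j t x).eval inp M ρ =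
    RAM.entry inp j (t.eval inp M ρ) (x.eval inp M ρ) := by
  rw [entry, eval, eval_entryCell]
  rfl

theorem inp_eval_entryCell (j : ℕ) (t x : Expr) : inp ((entryCell j t x).eval inp M ρ) =
    RAM.entry inp j (t.eval inp M ρ) (x.eval inp M ρ) := by
  rw [eval_entryCell]
  rfl

theorem holds_entry (j : ℕ) (t x : Expr) : (entry j t x).Holds inp M ρ ↔
    RAM.entry inp j (t.eval inp M ρ) (x.eval inp M ρ) ≠ 0 := by
  rw [Holds, eval_entry]

theorem holds_adj (a b : Expr) : (adj a b).Holds inp M ρ ↔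
    Adj inp (a.eval inp M ρ) (b.eval inp M ρ) := by
  simp only [adj, holds_ite, holds_lt, holds_conj, holds_le, holds_entry, Adj, eval_inp, eval_lit, eval_sub]

theorem eval_deg : (deg (var 2)).eval inp M ρ = RAM.deg inp (ρ 2) := by
  simp [deg, eval_ite, holds_entry, RAM.deg, Bound.val]

theorem eval_total : (total (var 2)).eval inp M ρ = RAM.total inp (ρ 2) := by
  simp [total, eval_entry, RAM.total, Bound.val]

theorem eval_owned : owned.eval inp M ρ = M .trial (ρ 2) - 1 := rfl

theorem holds_owned : owned.Holds inp M ρ ↔ M .trial (ρ 2) - 1 ≠ 0 := Iff.rfl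

theorem eval_ta : ta.eval inp M ρ = ρ 2 - inp 0 := rfl

theorem holds_courseOK :
    courseOK.Holds inp M ρ ↔ CourseOK inp (ρ 2) (M .trial (ρ 2) - 1) := by
  simp only [courseOK, CourseOK, holds_ite, holds_owned, holds_conj, holds_lt, holds_le, holds_eq,
    holds_entry, eval_entry, eval_owned, eval_deg, eval_total, eval_inp, eval_lit, eval_sub,
    eval_add, eval_mul, eval_var]

theorem holds_low : low.Holds inp M ρ ↔ Low inp (ρ 2 - inp 0) (ρ 6) := by
  simp [low, Low, holds_entry, eval_entry, inp_eval_entryCell, eval_ta, Bound.val]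

theorem holds_taOK : taOK.Holds inp M ρ ↔ TaOK inp (ρ 2 - inp 0) (M .trial (ρ 2) - 1) := by
  simp [taOK, TaOK, holds_low, holds_entry, eval_entry, eval_owned, holds_owned, eval_ta,
    Bound.val]

theorem holds_ok : ok.Holds inp M ρ ↔ OK inp (ρ 2) (M .trial (ρ 2) - 1) := by
  simp only [ok, OK, holds_ite, holds_lt, holds_courseOK, holds_taOK, eval_inp, eval_lit, eval_var]

theorem eval_neg_eq (a b c d : Expr) :
    (neg (eq a b)).eval inp M ρ = (eq c d).eval inp M ρ ↔
      (a.eval inp M ρ = b.eval inp M ρ ↔ ¬ c.eval inp M ρ = d.eval inp M ρ) := by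
  simp only [eq, neg, eval]
  omega

theorem holds_good : good.Holds inp M ρ ↔ Good inp (M .trial) := by
  simp [good, Good, holds_ok, holds_adj, holds_mem, eval_neg_eq, Bound.val, imp_iff_not_or]

end Expr

/-! ### The search by guessing and propagation -/

namespace Cmd

open RAM.Expr

def clear : Cmd := loop 2 .both (store .trial (var 2) (lit 0))

/-- One round of propagation: `var 3` owns its edge to `var 2` if it has to. -/
def spread : Cmd :=
  store .trial (var 3) (ite
    (conj (conj (eq (mem .trial (var 3)) (lit 0)) (mem .trial (var 2)))
      (conj (adj (var 2) (var 3)) (neg (eq (mem .trial (var 2)) (add (var 3) (lit 2))))))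
    (add (var 2) (lit 2)) (mem .trial (var 3)))

/-- Variable `4` merely counts sweeps over all pairs. One sweep advances at least one step backwards
along the functional graph, and no vertex needs more steps than there are vertices. -/
def spreadAll : Cmd := loop 4 .both (loop 2 .both (loop 3 .both spread))

def accept : Cmd :=
  loop 2 .both (store .ans (var 2) (ite (conj (mem .flag (lit 0)) (mem .trial (var 2)))
    (mem .trial (var 2)) (mem .ans (var 2))))

/-- Try out the choice that the vertex `var 0` owns what `var 1` says. -/
def attempt : Cmd :=
  seq clear (seq (store .trial (var 0) (add (var 1) (lit 1)))
    (seq spreadAll (seq (store .flag (lit 0) Expr.good) accept)))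

/-- The inner range has one value more than there are vertices, because a vertex may also own
nothing. -/
def solve : Cmd := loop 0 .both (loop 1 .succ attempt)

def output : Cmd :=
  seq (store .out (lit 0) (all 2 .both (mem .ans (var 2))))
    (loop 5 .right (store .out (add (var 5) (lit 1))
      (sub (mem .ans (add (inp (lit 0)) (var 5))) (lit 1))))

def main : Cmd := seq solve output

/-! ### Correctness of the search -/

variable {inp : ℕ → ℕ} {M : Arr → ℕ → ℕ} {ρ : ℕ → ℕ}

theorem clear_run (a : ℕ) (ha : a < inp 0 + inp 1) : clear.run inp ρ M .trial a = 0 := by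
  refine rounds_induction (N := inp 0 + inp 1)
    (fun j (M' : Arr → ℕ → ℕ) => ∀ a < j, M' .trial a = 0) (by simp) ?_ a ha
  intro j M' _ h a haj
  simp only [run, put_self, eval_lit, eval_var, Function.update_self]
  split_ifs with hc
  · rfl
  · exact h a (by omega)

theorem spread_run (a b c : ℕ) (ha : ρ 2 = a) (hb : ρ 3 = b) [Decidable (Adj inp a b)] :
    spread.run inp ρ M .trial c =
      if c = b ∧ M .trial b = 0 ∧ M .trial a ≠ 0 ∧ Adj inp a b ∧ M .trial a ≠ b + 2 then a + 2
      else M .trial c := by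
  by_cases hc : c = b
  · subst hc
    simp [spread, run, put_self, holds_adj, holds_mem, ha, hb, and_assoc]
  · simp [spread, run, put_self, hb, hc]

/-- The values of `T` agree with the solution `p`, and are nonzero only where `r` is reached. -/
def Follows (inp p : ℕ → ℕ) (r : ℕ) (T : ℕ → ℕ) : Prop :=
  ∀ b < inp 0 + inp 1, T b ≠ 0 → Reaches p r b ∧ T b = p b + 1

/-- Propagation is sound because every edge has exactly one owner: if `a` is known not to own its
edge to `b`, then `p b = a + 1`. The other two claims are monotonicity and progress. -/
theorem follows_spread {p : ℕ → ℕ} (hp : IsSol inp p) {r a b : ℕ}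
    (ha : a < inp 0 + inp 1) (hb : b < inp 0 + inp 1) (ha' : ρ 2 = a) (hb' : ρ 3 = b)
    (h : Follows inp p r (M .trial)) :
    Follows inp p r (spread.run inp ρ M .trial) ∧
      (∀ c, M .trial c ≠ 0 → spread.run inp ρ M .trial c ≠ 0) ∧
      (M .trial a ≠ 0 → p b = a + 1 → spread.run inp ρ M .trial b ≠ 0) := by
  classical
  refine ⟨fun c hc hne => ?_, fun c hne => ?_, fun hne hpb => ?_⟩
  · rw [spread_run a b c ha' hb'] at hne ⊢
    split_ifs at hne ⊢ with hs
    · obtain ⟨rfl, h1, h2, h3, h4⟩ := hs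
      obtain ⟨h5, h6⟩ := h a ha h2
      have h7 : p c = a + 1 := by
        by_contra h7
        have := ((hp a ha).2 c hb h3).2 h7
        omega
      exact ⟨reaches_of_next (by rwa [next_of_eq h7]), by omega⟩
    · exact h c hc hne
  · rw [spread_run a b c ha' hb']
    split_ifs
    · omega
    · exact hne
  · rw [spread_run a b b ha' hb']
    split_ifs with hs
    · omega
    · intro h0
      have hok := (hp b hb).1
      rw [hpb] at hok
      have hadj := (hok.adj).2
      -- If `a` also owned the edge, it would have two owners under `p`.
      refine hs ⟨rfl, h0, hne, hadj.symm, fun hc => ?_⟩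
      have h1 := (h a ha hne).2
      have h2 := (hp b hb).2 a ha hadj
      omega

theorem follows_row {p : ℕ → ℕ} (hp : IsSol inp p) {r a : ℕ}
    (ha : a < inp 0 + inp 1) (ha' : ρ 2 = a) (h : Follows inp p r (M .trial)) :
    Follows inp p r ((loop 3 .both spread).run inp ρ M .trial) ∧
      (∀ c, M .trial c ≠ 0 → (loop 3 .both spread).run inp ρ M .trial c ≠ 0) ∧
      ∀ b < inp 0 + inp 1, M .trial a ≠ 0 → p b = a + 1 →
        (loop 3 .both spread).run inp ρ M .trial b ≠ 0 := by
  refine rounds_induction (N := inp 0 + inp 1) (fun j (M' : Arr → ℕ → ℕ) => Follows inp p r (M' .trial) ∧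
      (∀ c, M .trial c ≠ 0 → M' .trial c ≠ 0) ∧
      ∀ b < j, M .trial a ≠ 0 → p b = a + 1 → M' .trial b ≠ 0) ⟨h, fun _ => id, by simp⟩ ?_
  rintro j M' hj ⟨h1, h2, h3⟩
  obtain ⟨h4, h5, h6⟩ := follows_spread (ρ := Function.update ρ 3 j) hp ha hj (by simpa using ha')
    (by simp) h1
  refine ⟨h4, fun c hc => h5 c (h2 c hc), fun b hb hne hpb => ?_⟩
  rcases Nat.lt_succ_iff_lt_or_eq.1 hb with hb | rfl
  · exact h5 b (h3 b hb hne hpb)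
  · exact h6 (h2 a hne) hpb

theorem follows_table {p : ℕ → ℕ} (hp : IsSol inp p) {r : ℕ} (h : Follows inp p r (M .trial)) :
    Follows inp p r ((loop 2 .both (loop 3 .both spread)).run inp ρ M .trial) ∧
      (∀ c, M .trial c ≠ 0 → (loop 2 .both (loop 3 .both spread)).run inp ρ M .trial c ≠ 0) ∧
      ∀ a < inp 0 + inp 1, ∀ b < inp 0 + inp 1, M .trial a ≠ 0 → p b = a + 1 →
        (loop 2 .both (loop 3 .both spread)).run inp ρ M .trial b ≠ 0 := by
  refine rounds_induction (N := inp 0 + inp 1) (fun j (M' : Arr → ℕ → ℕ) => Follows inp p r (M' .trial) ∧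
      (∀ c, M .trial c ≠ 0 → M' .trial c ≠ 0) ∧
      ∀ a < j, ∀ b < inp 0 + inp 1, M .trial a ≠ 0 → p b = a + 1 → M' .trial b ≠ 0)
      ⟨h, fun _ => id, by simp⟩ ?_
  rintro j M' hj ⟨h1, h2, h3⟩
  obtain ⟨h4, h5, h6⟩ := follows_row (ρ := Function.update ρ 2 j) hp hj (by simp) h1
  refine ⟨h4, fun c hc => h5 c (h2 c hc), fun a ha b hb hne hpb => ?_⟩
  rcases Nat.lt_succ_iff_lt_or_eq.1 ha with ha | rfl
  · exact h5 b (h3 a ha b hb hne hpb)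
  · exact h6 b hb (h2 a hne) hpb

/-- After `j` sweeps, every vertex that reaches `r` in at most `j` steps is filled;
`Reaches.exists_le` shows that the number of sweeps suffices. -/
theorem follows_spreadAll {p : ℕ → ℕ} (hp : IsSol inp p) {r : ℕ}
    (h : Follows inp p r (M .trial)) (hr : M .trial r ≠ 0) :
    Follows inp p r (spreadAll.run inp ρ M .trial) ∧
      ∀ b < inp 0 + inp 1, Reaches p r b → spreadAll.run inp ρ M .trial b ≠ 0 := by
  have key : Follows inp p r (spreadAll.run inp ρ M .trial) ∧
      ∀ b < inp 0 + inp 1, ∀ i ≤ inp 0 + inp 1, (next p)^[i] b = r →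
        spreadAll.run inp ρ M .trial b ≠ 0 := by
    refine rounds_induction (N := inp 0 + inp 1) (fun j (M' : Arr → ℕ → ℕ) => Follows inp p r (M' .trial) ∧
      ∀ b < inp 0 + inp 1, ∀ i ≤ j, (next p)^[i] b = r → M' .trial b ≠ 0) ⟨h, ?_⟩ ?_
    · rintro b - i hi hb
      obtain rfl : i = 0 := by omega
      obtain rfl : b = r := hb
      exact hr
    · rintro j M' hj ⟨h1, h2⟩
      obtain ⟨h4, h5, h6⟩ := follows_table (ρ := Function.update ρ 4 j) hp h1
      refine ⟨h4, fun b hb i hi hbr => ?_⟩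
      obtain _ | i := i
      · exact h5 b (h2 b hb 0 (by omega) hbr)
      · rw [Function.iterate_succ_apply] at hbr
        have hne := h2 _ (hp.next_lt hb) i (by omega) hbr
        -- A vertex that owns nothing is its own successor, hence already filled.
        by_cases hpb : p b = 0
        · rw [show next p b = b by simp [next, hpb]] at hne
          exact h5 b hne
        · refine h6 _ (hp.next_lt hb) b hb hne ?_
          simp only [next, hpb, if_false]
          omega
  refine ⟨key.1, fun b hb hbr => ?_⟩
  obtain ⟨i, hi, hir⟩ := hbr.exists_le hp hb
  exact key.2 b hb i hi hir

/-- The support of `T` is exactly the set of vertices that reach `r`, a union of components by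
`Reaches.adj`, and there `T` copies the solution. -/
theorem Follows.good {p T : ℕ → ℕ} (hp : IsSol inp p) {r : ℕ} (hr : Recurrent p r)
    (h : Follows inp p r T) (h' : ∀ b < inp 0 + inp 1, Reaches p r b → T b ≠ 0) :
    Good inp T := by
  intro a ha
  by_cases h0 : T a = 0
  · exact Or.inl h0
  · obtain ⟨h1, h2⟩ := h a ha h0
    refine Or.inr ⟨by rw [h2]; exact (hp a ha).1, fun b hb hab => ?_⟩
    have h3 := h' b hb (h1.adj hp hr ha hb hab)
    have h4 := (h b hb h3).2
    have h5 := (hp a ha).2 b hb hab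
    refine ⟨h3, ?_⟩
    rw [h2, h4]
    omega

open Classical in
theorem accept_run (a : ℕ) (ha : a < inp 0 + inp 1) : accept.run inp ρ M .ans a =
    if M .flag 0 ≠ 0 ∧ M .trial a ≠ 0 then M .trial a else M .ans a := by
  have key := rounds_induction (N := inp 0 + inp 1) (M := M)
    (f := fun j M => (store .ans (var 2) (ite (conj (mem .flag (lit 0)) (mem .trial (var 2)))
      (mem .trial (var 2)) (mem .ans (var 2)))).run inp (Function.update ρ 2 j) M)
    (fun j (M' : Arr → ℕ → ℕ) => M' .flag = M .flag ∧ M' .trial = M .trial ∧ ∀ a, M' .ans a =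
      if a < j ∧ M .flag 0 ≠ 0 ∧ M .trial a ≠ 0 then M .trial a else M .ans a)
    ⟨rfl, rfl, by simp⟩ ?_
  · have := key.2.2 a
    simp only [ha, true_and] at this
    exact this
  · rintro j M' - ⟨h1, h2, h3⟩
    refine ⟨by rw [run, put_of_ne _ _ _ (by decide), h1],
      by rw [run, put_of_ne _ _ _ (by decide), h2], fun c => ?_⟩
    simp only [run, put_self, eval_ite, holds_conj, holds_mem, eval_lit, eval_var, eval_mem,
      Function.update_self, h1, h2, h3]
    by_cases hc : c = j
    · subst hc
      simp
    · have : c < j + 1 ↔ c < j := by omega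
      simp [hc, this]

/-- The first two claims hold for every guess, since a bad trial is discarded by the check and a
good one only overwrites whole components. The last says that the right guess at a recurrent vertex
fills everything that reaches it. The solution `p` need not be the one stored in the answer. -/
theorem attempt_run (r o : ℕ) (hr : ρ 0 = r) (ho : ρ 1 = o) (h : Good inp (M .ans)) :
    Good inp (attempt.run inp ρ M .ans) ∧
      (∀ v < inp 0 + inp 1, M .ans v ≠ 0 → attempt.run inp ρ M .ans v ≠ 0) ∧
      ∀ p, IsSol inp p → r < inp 0 + inp 1 → o = p r → Recurrent p r →
        ∀ v < inp 0 + inp 1, Reaches p r v → attempt.run inp ρ M .ans v ≠ 0 := by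
  set M₁ := clear.run inp ρ M with h₁
  set M₂ := put M₁ .trial r (o + 1) with h₂
  set M₃ := spreadAll.run inp ρ M₂ with h₃
  set M₄ := (store .flag (lit 0) Expr.good).run inp ρ M₃ with h₄
  have hrun : attempt.run inp ρ M = accept.run inp ρ M₄ := by
    simp only [attempt, run, eval_lit, eval_var, eval_add, hr, ho, ← h₁, ← h₂, ← h₃, h₄]
  have hans : M₄ .ans = M .ans := by
    rw [h₄, Avoids.run_eq (by simp [Avoids]), h₃,
      Avoids.run_eq (by simp [Avoids, spreadAll, spread]), h₂, put_of_ne _ _ _ (by decide), h₁,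
      Avoids.run_eq (by simp [Avoids, clear])]
  have htrial : M₄ .trial = M₃ .trial := by rw [h₄, Avoids.run_eq (by simp [Avoids])]
  have hflag : M₄ .flag 0 ≠ 0 ↔ Good inp (M₃ .trial) := by
    rw [h₄]
    simp only [run, eval_lit, put_self, if_true]
    exact holds_good
  have hres : ∀ a < inp 0 + inp 1, attempt.run inp ρ M .ans a =
      if M₄ .flag 0 ≠ 0 ∧ M₃ .trial a ≠ 0 then M₃ .trial a else M .ans a := by
    intro a ha
    rw [hrun, accept_run a ha, hans, htrial]
  refine ⟨?_, fun v hv hne => ?_, fun p hp hrN hop hrec v hv hvr => ?_⟩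
  · by_cases hf : M₄ .flag 0 ≠ 0
    · exact h.merge (hflag.1 hf) fun a ha => by rw [hres a ha]; simp [hf]
    · intro a ha
      have : ∀ a < inp 0 + inp 1, attempt.run inp ρ M .ans a = M .ans a := fun a ha => by
        rw [hres a ha, if_neg fun hc => hf hc.1]
      rw [this a ha]
      refine (h a ha).imp id fun h' => ⟨h'.1, fun b hb => ?_⟩
      rw [this b hb]
      exact h'.2 b hb
  · rw [hres v hv]
    split_ifs with hc
    · exact hc.2
    · exact hne
  · have hF : Follows inp p r (M₂ .trial) := by
      intro b hb hne
      rw [h₂, put_self] at hne ⊢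
      split_ifs at hne ⊢ with hbr
      · exact ⟨⟨0, hbr⟩, by rw [hbr, hop]⟩
      · exact absurd (clear_run b hb) hne
    obtain ⟨hF₃, hne₃⟩ := follows_spreadAll (ρ := ρ) hp hF (by simp [h₂, put_self])
    have hG := hflag.2 (hF₃.good hp hrec hne₃)
    rw [hres v hv, if_pos ⟨hG, hne₃ v hv hvr⟩]
    exact hne₃ v hv hvr

theorem _root_.RAM.IsSol.le {p : ℕ → ℕ} (hp : IsSol inp p) {a : ℕ} (ha : a < inp 0 + inp 1) :
    p a < inp 0 + inp 1 + 1 := by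
  by_cases h : p a = 0
  · omega
  · obtain ⟨w, hw⟩ := Nat.exists_eq_succ_of_ne_zero h
    have := (hp a ha).1
    rw [hw] at this ⊢
    have := (this.adj).1
    omega

/-- All recurrent `r` and all choices are tried and filled vertices stay filled. By
`exists_recurrent` each vertex reaches some such `r`. -/
theorem solve_run (h : Good inp (M .ans)) :
    Good inp (solve.run inp ρ M .ans) ∧ ∀ p, IsSol inp p →
      ∀ v < inp 0 + inp 1, solve.run inp ρ M .ans v ≠ 0 := by
  have key : Good inp (solve.run inp ρ M .ans) ∧
      ∀ p, IsSol inp p → ∀ r < inp 0 + inp 1, Recurrent p r →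
        ∀ v < inp 0 + inp 1, Reaches p r v → solve.run inp ρ M .ans v ≠ 0 := by
    have := rounds_induction (N := inp 0 + inp 1) (M := M)
      (f := fun j M => (loop 1 .succ attempt).run inp (Function.update ρ 0 j) M)
      (fun j (M' : Arr → ℕ → ℕ) => Good inp (M' .ans) ∧ ∀ p, IsSol inp p → ∀ r < j, r < inp 0 + inp 1 →
        Recurrent p r → ∀ v < inp 0 + inp 1, Reaches p r v → M' .ans v ≠ 0)
      ⟨h, by simp⟩ ?_
    · exact ⟨this.1, fun p hp r hr => this.2 p hp r hr hr⟩
    rintro r M₁ - ⟨hg₁, hs₁⟩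
    have := rounds_induction (N := inp 0 + inp 1 + 1) (M := M₁)
      (f := fun j M => attempt.run inp (Function.update (Function.update ρ 0 r) 1 j) M)
      (fun j (M' : Arr → ℕ → ℕ) => Good inp (M' .ans) ∧ (∀ v < inp 0 + inp 1, M₁ .ans v ≠ 0 → M' .ans v ≠ 0) ∧
        ∀ p, IsSol inp p → r < inp 0 + inp 1 → p r < j → Recurrent p r →
          ∀ v < inp 0 + inp 1, Reaches p r v → M' .ans v ≠ 0)
      ⟨hg₁, fun _ _ => id, by simp⟩ ?_
    · refine ⟨this.1, fun p hp r' hr' hr'N hrec v hv hvr => ?_⟩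
      rcases Nat.lt_succ_iff_lt_or_eq.1 hr' with hr' | rfl
      · exact this.2.1 v hv (hs₁ p hp r' hr' hr'N hrec v hv hvr)
      · exact this.2.2 p hp hr'N (hp.le hr'N) hrec v hv hvr
    rintro o M₂ - ⟨hg₂, hm₂, hs₂⟩
    obtain ⟨hg, hm, hs⟩ := attempt_run
      (ρ := Function.update (Function.update ρ 0 r) 1 o) r o (by simp) (by simp) hg₂
    refine ⟨hg, fun v hv hne => hm v hv (hm₂ v hv hne), fun p hp hrN hlt hrec v hv hvr => ?_⟩
    rcases Nat.lt_succ_iff_lt_or_eq.1 hlt with hlt | heq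
    · exact hm v hv (hs₂ p hp hrN hlt hrec v hv hvr)
    · exact hs p hp hrN heq.symm hrec v hv hvr
  refine ⟨key.1, fun p hp v hv => ?_⟩
  obtain ⟨r, hr, hrec, hvr⟩ := hp.exists_recurrent hv
  exact key.2 p hp r hr hrec v hv hvr

theorem output_run : (output.run inp ρ M .out 0 =
      open Classical in if ∀ a < inp 0 + inp 1, M .ans a ≠ 0 then 1 else 0) ∧
    ∀ t < inp 1, output.run inp ρ M .out (t + 1) = M .ans (inp 0 + t) - 1 := by
  classical
  have hav : (store .out (lit 0) (all 2 .both (mem .ans (var 2)))).Avoids .ans := by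
    simp [Avoids]
  set M₁ := (store .out (lit 0) (all 2 .both (mem .ans (var 2)))).run inp ρ M with h₁
  have hans : M₁ .ans = M .ans := hav.run_eq _ _
  have hout : M₁ .out 0 = if ∀ a < inp 0 + inp 1, M .ans a ≠ 0 then 1 else 0 := by
    simp [h₁, run, put_self, eval_all, holds_mem, Bound.val]
  have := rounds_induction (N := inp 1) (M := M₁)
    (f := fun j M => (store .out (add (var 5) (lit 1))
      (sub (mem .ans (add (Expr.inp (lit 0)) (var 5))) (lit 1))).run inp (Function.update ρ 5 j) M)
    (fun j (M' : Arr → ℕ → ℕ) => M' .ans = M .ans ∧ M' .out 0 = M₁ .out 0 ∧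
      ∀ t < j, M' .out (t + 1) = M .ans (inp 0 + t) - 1) ⟨hans, rfl, by simp⟩ ?_
  · exact ⟨this.2.1.trans hout, this.2.2⟩
  rintro j M' - ⟨h2, h3, h4⟩
  refine ⟨by rw [run, put_of_ne _ _ _ (by decide), h2], ?_, fun t ht => ?_⟩
  · simp [run, put_self, h3]
  · simp only [run, put_self, eval_lit, eval_var, eval_add, eval_sub, eval_mem, eval_inp,
      Function.update_self, h2, Nat.add_right_cancel_iff]
    split_ifs with hc
    · rw [hc]
    · exact h4 t (by omega)

/-- The program finds a solution or reports that there is none. -/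
theorem main_run (h : ∀ a, M .ans a = 0) :
    (main.run inp ρ M .out 0 = 1 ∧ ∃ p, IsSol inp p ∧
      ∀ t < inp 1, main.run inp ρ M .out (t + 1) = p (inp 0 + t)) ∨
    (main.run inp ρ M .out 0 = 0 ∧ ¬ ∃ p, IsSol inp p) := by
  have hg : Good inp (M .ans) := fun a _ => Or.inl (h a)
  obtain ⟨h1, h2⟩ := solve_run (ρ := ρ) hg
  obtain ⟨h3, h4⟩ := output_run (inp := inp) (ρ := ρ) (M := solve.run inp ρ M)
  by_cases hc : ∀ a < inp 0 + inp 1, solve.run inp ρ M .ans a ≠ 0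
  · rw [if_pos hc] at h3
    exact Or.inl ⟨h3, _, h1.isSol hc, h4⟩
  · rw [if_neg hc] at h3
    exact Or.inr ⟨h3, fun ⟨p, hp⟩ => hc (h2 p hp)⟩

end Cmd

end RAM

namespace MEFE

open RAM (entry)

/-! ### Reading an encoded instance -/

namespace Instance

/-- Address arithmetic for blocks of equal length `c`; it is used for the TAs and, within each, for
the courses. -/
theorem getD_flatMap {α β : Type} (f : α → List β) (c : ℕ) (hc : ∀ a, (f a).length = c) (d : β) :
    ∀ (l : List α) (i j : ℕ) (hi : i < l.length), j < c →
      (l.flatMap f).getD (c * i + j) d = (f l[i]).getD j d := by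
  intro l
  induction l with
  | nil => intro i j hi; simp at hi
  | cons a l ih =>
    intro i j hi hj
    rw [List.flatMap_cons]
    obtain _ | i := i
    · rw [List.getD_append _ _ _ _ (by rw [hc]; omega)]
      simp
    · rw [List.getD_append_right _ _ _ _ (by rw [hc, Nat.mul_succ]; omega), hc,
        show c * (i + 1) + j - c = c * i + j by rw [Nat.mul_succ]; omega,
        ih i j (by simpa using hi) hj]
      simp

variable (I : Instance)

/-- The cells of the input. -/
def input (i : ℕ) : ℕ := I.encode.getD i 0

@[simp] theorem input_zero : I.input 0 = I.n := rfl

@[simp] theorem input_one : I.input 1 = I.m := rfl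

@[simp] theorem input_two : I.input 2 = I.k.num := rfl

@[simp] theorem input_three : I.input 3 = I.k.den := rfl

@[simp] theorem input_cap (x : Fin I.n) : I.input (4 + x) = I.cap x := by
  rw [input, encode, List.getD_append _ _ _ _ (by simp; omega),
    List.getD_append_right _ _ _ _ (by simp)]
  simp

theorem entry_input {j : ℕ} (hj : j < 4) (t : Fin I.m) (x : Fin I.n) :
    entry I.input j t x = [I.u t x, I.v x t, (I.g t x).num, (I.g t x).den].getD j 0 := by
  rw [entry, input, input_zero, encode, List.getD_append_right _ _ _ _ (by simp; omega)]
  have hx := x.2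
  have hlen : ∀ t : Fin I.m, ((List.finRange I.n).flatMap fun x =>
      [I.u t x, I.v x t, (I.g t x).num, (I.g t x).den]).length = 4 * I.n := by
    intro t
    simp [List.length_flatMap]
    ring
  have hidx : 4 + (I.n + (4 * (I.n * t + x) + j)) -
      ([I.n, I.m, I.k.num, I.k.den] ++ List.ofFn I.cap).length = 4 * I.n * t + (4 * x + j) := by
    simp
    ring_nf
    omega
  rw [hidx, getD_flatMap _ _ hlen _ _ _ _ (by simp) (by omega),
    getD_flatMap _ 4 (by simp) _ _ _ _ (by simp) hj]
  simp

@[simp] theorem entry_input_zero (t : Fin I.m) (x : Fin I.n) :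
    entry I.input 0 t x = I.u t x := I.entry_input (by norm_num) t x

@[simp] theorem entry_input_one (t : Fin I.m) (x : Fin I.n) :
    entry I.input 1 t x = I.v x t := I.entry_input (by norm_num) t x

@[simp] theorem entry_input_two (t : Fin I.m) (x : Fin I.n) :
    entry I.input 2 t x = (I.g t x).num := I.entry_input (by norm_num) t x

@[simp] theorem entry_input_three (t : Fin I.m) (x : Fin I.n) :
    entry I.input 3 t x = (I.g t x).den := I.entry_input (by norm_num) t x

theorem size_input_le (i : ℕ) : (I.input i).size ≤ RAM.inputLength I.encode := by
  by_cases hi : i < I.encode.length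
  · rw [input, List.getD_eq_getElem _ _ hi]
    have : (I.encode[i]).size + 1 ∈ I.encode.map fun n => n.size + 1 :=
      List.mem_map_of_mem (List.getElem_mem hi)
    have := List.le_sum_of_mem this
    unfold RAM.inputLength
    omega
  · rw [input, List.getD_eq_default _ _ (by omega)]
    simp

theorem length_le_inputLength (l : List ℕ) : l.length ≤ RAM.inputLength l := by
  unfold RAM.inputLength
  induction l with
  | nil => simp
  | cons a l ih =>
    simp
    simp at ih
    omega

/-- With at least one course, every TA contributes entries to the list. Without courses only the
binary number `I.m` is written, and the bound can fail. -/
theorem vertices_le (hn : 0 < I.n) : I.n + I.m + 1 ≤ RAM.inputLength I.encode := by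
  refine le_trans ?_ (length_le_inputLength _)
  have : I.m * 1 ≤ I.m * I.n := Nat.mul_le_mul_left _ hn
  simp [encode, List.length_flatMap, ← mul_assoc]
  omega

/-! ### The local conditions in terms of the instance -/

/-- The TAs that a course values positively. -/
def nbrs (x : Fin I.n) : Finset (Fin I.m) := Finset.univ.filter fun t => 0 < I.v x t

variable {I}

theorem mem_nbrs {x : Fin I.n} {t : Fin I.m} : t ∈ I.nbrs x ↔ I.u t x ≠ 0 := by
  simp [nbrs, ← I.v_eq_zero_iff, Nat.pos_iff_ne_zero]

theorem deg_input (x : Fin I.n) : RAM.deg I.input x = (I.nbrs x).card := by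
  have : I.nbrs x = Finset.univ.filter fun t => I.u t x ≠ 0 := by
    ext t
    simp [mem_nbrs]
  rw [this, RAM.deg, input_one, Finset.sum_range, Finset.card_filter]
  simp

theorem total_input (x : Fin I.n) : RAM.total I.input x = ∑ t ∈ I.nbrs x, I.v x t := by
  rw [RAM.total, input_one, Finset.sum_range, nbrs, Finset.sum_filter_of_ne]
  · simp
  · intro t _ h
    omega

/-- The truncated subtraction is exact, as the dropped TA contributes to the total. -/
theorem total_sub (x : Fin I.n) {t : Fin I.m} (ht : t ∈ I.nbrs x) :
    RAM.total I.input x - I.v x t = ∑ t ∈ (I.nbrs x).erase t, I.v x t := by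
  rw [total_input, ← Finset.add_sum_erase _ _ ht, Nat.add_sub_cancel_left]

theorem le_iff_num_mul_den_le (q r : NNRat) : q ≤ r ↔ q.num * r.den ≤ r.num * q.den := by
  conv_lhs => rw [← NNRat.num_div_den q, ← NNRat.num_div_den r]
  rw [div_le_div_iff₀ (by exact_mod_cast q.den_pos) (by exact_mod_cast r.den_pos)]
  norm_cast

theorem le_avg_iff (k : NNRat) {c : ℕ} (hc : 0 < c) (n : ℕ) :
    (k : ℚ) ≤ (n : ℚ) / (c : ℚ) ↔ k.num * c ≤ k.den * n := by
  have h1 : (k : ℚ) = (k.num : ℚ) / (k.den : ℚ) := by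
    conv_lhs => rw [← NNRat.num_div_den k]
    push_cast
    rfl
  rw [h1, div_le_div_iff₀ (by exact_mod_cast k.den_pos) (by exact_mod_cast hc), mul_comm (n : ℚ)]
  norm_cast

theorem le_avgUtil_iff (μ : I.Matching) (x : Fin I.n) :
    (I.k : ℚ) ≤ μ.avgUtil x ↔ I.k.num * I.cap x ≤ I.k.den * ∑ t ∈ μ.assigned x, I.v x t := by
  rw [← le_avg_iff _ (I.cap_pos x), Matching.avgUtil]
  push_cast
  rfl

theorem low_input (t : Fin I.m) (x : Fin I.n) : RAM.Low I.input t x ↔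
    ∀ t', t' ≠ t → I.u t' x ≠ 0 → ¬ I.g t' x ≤ I.g t x := by
  simp only [le_iff_num_mul_den_le]
  constructor
  · intro h t' hne hu
    have := h t' t'.2
    simp only [entry_input_zero, entry_input_two, entry_input_three, hu, false_or,
      Fin.val_inj, hne] at this
    exact this
  · intro h t' ht'
    have := h ⟨t', ht'⟩
    have h0 := I.entry_input_zero ⟨t', ht'⟩ x
    have h2 := I.entry_input_two ⟨t', ht'⟩ x
    have h3 := I.entry_input_three ⟨t', ht'⟩ x
    simp only at h0 h2 h3
    rw [entry_input_two, entry_input_three, h0, h2, h3]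
    by_cases h4 : t' = t
    · exact Or.inl h4
    · by_cases h5 : I.u ⟨t', ht'⟩ x = 0
      · exact Or.inr (Or.inl h5)
      · exact Or.inr (Or.inr (this (fun hc => h4 (congrArg Fin.val hc)) h5))

theorem adj_input (x : Fin I.n) (t : Fin I.m) :
    RAM.Adj I.input x (I.n + t) ↔ I.u t x ≠ 0 := by
  simp [RAM.Adj]

theorem courseOK_zero (x : Fin I.n) : RAM.OK I.input x 0 ↔ (I.nbrs x).card = I.cap x ∧
    I.k.num * I.cap x ≤ I.k.den * ∑ t ∈ I.nbrs x, I.v x t := by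
  simp [RAM.OK, RAM.CourseOK, deg_input, total_input]

theorem courseOK_succ (x : Fin I.n) (t : Fin I.m) : RAM.OK I.input x (I.n + t + 1) ↔
    t ∈ I.nbrs x ∧ (I.nbrs x).card = I.cap x + 1 ∧
      I.k.num * I.cap x ≤ I.k.den * ∑ t ∈ (I.nbrs x).erase t, I.v x t := by
  have ht : I.n + (t : ℕ) + 1 ≤ I.n + I.m := by omega
  have hn : I.n < I.n + (t : ℕ) + 1 := by omega
  by_cases h : t ∈ I.nbrs x
  · simp only [RAM.OK, RAM.CourseOK, input_zero, x.2, if_true, ne_eq, Nat.add_eq_zero_iff,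
      one_ne_zero, and_false, not_false_eq_true, Nat.add_sub_cancel, Nat.add_sub_cancel_left,
      entry_input_zero, entry_input_one, total_sub x h, deg_input, input_cap, input_one,
      input_two, input_three, mem_nbrs.1 h, h, true_and, ht, hn]
  · simp only [RAM.OK, RAM.CourseOK, input_zero, x.2, if_true, ne_eq, Nat.add_eq_zero_iff,
      one_ne_zero, and_false, not_false_eq_true, Nat.add_sub_cancel, Nat.add_sub_cancel_left,
      entry_input_zero, ← mem_nbrs, h, false_and]

theorem taOK_code (t : Fin I.m) (o : Option (Fin I.n)) : RAM.OK I.input (I.n + t) (I.code o) ↔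
    (∀ x, o = some x → I.u t x ≠ 0) ∧
      ∀ x, I.u t x ≤ o.elim 0 (I.u t) ∨ RAM.Low I.input t x := by
  have h : (∀ x < I.n, entry I.input 0 t x ≤ o.elim 0 (I.u t) ∨ RAM.Low I.input t x) ↔
      ∀ x, I.u t x ≤ o.elim 0 (I.u t) ∨ RAM.Low I.input t x := by
    constructor
    · intro h x
      simpa using h x x.2
    · intro h x hx
      have := I.entry_input_zero t ⟨x, hx⟩
      simp only at this
      rw [this]
      exact h ⟨x, hx⟩
  rw [← h]
  rcases o with _ | y
  · simp [RAM.OK, RAM.TaOK, code]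
  · have := y.2
    simp [RAM.OK, RAM.TaOK, code]

/-! ### From matchings to solutions -/

theorem mem_assigned {μ : I.Matching} {x : Fin I.n} {t : Fin I.m} :
    t ∈ μ.assigned x ↔ μ t = some x := by simp [Matching.assigned]

theorem Matching.IsFeasible.assigned_subset {μ : I.Matching} (h : μ.IsFeasible) (x : Fin I.n) :
    μ.assigned x ⊆ I.nbrs x := fun t ht => mem_nbrs.2 (h.2 t x (mem_assigned.1 ht))

/-- Here the bound on the degree enters: at most one neighbour of `x` lies outside the `I.cap x`
assigned ones. -/
theorem Matching.IsFeasible.dropped_unique {μ : I.Matching} (h : μ.IsFeasible) {x : Fin I.n}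
    (hd : (I.nbrs x).card ≤ I.cap x + 1) {t t' : Fin I.m} (ht : I.u t x ≠ 0) (ht' : I.u t' x ≠ 0)
    (hn : μ t ≠ some x) (hn' : μ t' ≠ some x) : t = t' := by
  have h1 : (I.nbrs x \ μ.assigned x).card ≤ 1 := by
    rw [Finset.card_sdiff_of_subset (h.assigned_subset x), h.1 x]
    omega
  refine Finset.card_le_one.1 h1 t ?_ t' ?_
  · simp [mem_nbrs, mem_assigned, ht, hn]
  · simp [mem_nbrs, mem_assigned, ht', hn']

theorem code_eq_succ {o : Option (Fin I.n)} {x : Fin I.n} :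
    I.code o = (x : ℕ) + 1 ↔ o = some x := by
  rcases o with _ | y <;> simp [code, Fin.val_inj]

open Classical in
/-- The solution that corresponds to a matching: a course owns the edge to the TA it drops. -/
noncomputable def Matching.toSol (μ : I.Matching) (a : ℕ) : ℕ :=
  if ha : a < I.n then
    if h : ∃ t, I.u t ⟨a, ha⟩ ≠ 0 ∧ μ t ≠ some ⟨a, ha⟩ then I.n + h.choose + 1 else 0
  else if ht : a - I.n < I.m then I.code (μ ⟨a - I.n, ht⟩) else 0

theorem Matching.toSol_ta (μ : I.Matching) (t : Fin I.m) : μ.toSol (I.n + t) = I.code (μ t) := by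
  simp [toSol]

theorem Matching.toSol_course_eq_succ {μ : I.Matching} (h : μ.IsFeasible) {x : Fin I.n}
    (hd : (I.nbrs x).card ≤ I.cap x + 1) {t : Fin I.m} (ht : I.u t x ≠ 0) :
    μ.toSol x = I.n + t + 1 ↔ μ t ≠ some x := by
  by_cases hc : ∃ t, I.u t x ≠ 0 ∧ μ t ≠ some x
  · have h1 : μ.toSol x = I.n + hc.choose + 1 := by
      rw [toSol, dif_pos x.2, dif_pos hc]
    obtain ⟨h2, h3⟩ := hc.choose_spec
    rw [h1]
    constructor
    · intro h4
      have : hc.choose = t := Fin.ext (by omega)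
      rwa [← this]
    · intro h4
      rw [h.dropped_unique hd h2 ht h3 h4]
  · have h1 : μ.toSol x = 0 := by
      rw [toSol, dif_pos x.2, dif_neg hc]
    rw [h1]
    push Not at hc
    simp [hc t ht]

theorem Matching.IsFeasible.assigned_eq_erase {μ : I.Matching} (h : μ.IsFeasible) {x : Fin I.n}
    (hd : (I.nbrs x).card ≤ I.cap x + 1) {t : Fin I.m} (ht : I.u t x ≠ 0) (hn : μ t ≠ some x) :
    μ.assigned x = (I.nbrs x).erase t := by
  ext t'
  rw [Finset.mem_erase, mem_assigned, mem_nbrs]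
  constructor
  · intro h1
    exact ⟨fun hc => hn (hc ▸ h1), h.2 _ _ h1⟩
  · rintro ⟨h1, h2⟩
    by_contra h3
    exact h1 (h.dropped_unique hd h2 ht h3 hn)

theorem Matching.IsMEFE.isSol {μ : I.Matching} (h : μ.IsMEFE)
    (hd : ∀ x, (I.nbrs x).card ≤ I.cap x + 1) : RAM.IsSol I.input μ.toSol := by
  obtain ⟨hf, hk, he⟩ := h
  have hcourse : ∀ x : Fin I.n, RAM.OK I.input x (μ.toSol x) := by
    intro x
    have hkx := (le_avgUtil_iff μ x).1 (hk x)
    by_cases hc : ∃ t, I.u t x ≠ 0 ∧ μ t ≠ some x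
    · obtain ⟨t, ht, hn⟩ := hc
      have hS := hf.assigned_eq_erase (hd x) ht hn
      rw [(toSol_course_eq_succ hf (hd x) ht).2 hn, courseOK_succ]
      refine ⟨mem_nbrs.2 ht, ?_, by rwa [← hS]⟩
      rw [← hf.1 x, hS, Finset.card_erase_add_one (mem_nbrs.2 ht)]
    · have h1 : μ.toSol x = 0 := by
        rw [toSol, dif_pos x.2, dif_neg hc]
      push Not at hc
      have hS : μ.assigned x = I.nbrs x := (hf.assigned_subset x).antisymm fun t ht =>
        mem_assigned.2 (hc t (mem_nbrs.1 ht))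
      rw [h1, courseOK_zero, ← hS]
      exact ⟨hf.1 x, hkx⟩
  have hta : ∀ t : Fin I.m, RAM.OK I.input (I.n + t) (μ.toSol (I.n + t)) := by
    intro t
    rw [toSol_ta, taOK_code]
    -- If `t` prefers `x` to its assignment, then `t` is the TA dropped by `x`. Every other
    -- neighbour `t'` is therefore assigned to `x`, so a grade of `t'` not above that of `t` would
    -- cause envy.
    refine ⟨fun x hx => hf.2 t x hx, fun x => or_iff_not_imp_left.2 fun hlt => ?_⟩
    rw [low_input]
    intro t' hne hu hg
    have hut : I.u t x ≠ 0 := fun h0 => hlt (by rw [h0]; exact Nat.zero_le _)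
    have hn : μ t ≠ some x := fun hc => hlt (by rw [hc]; rfl)
    have h' : μ t' = some x := by
      by_contra h'
      exact hne (hf.dropped_unique (hd x) hu hut h' hn)
    exact he t t' ⟨x, h', hg, not_le.1 hlt⟩
  have hedge : ∀ (x : Fin I.n) (t : Fin I.m), I.u t x ≠ 0 →
      (μ.toSol x = I.n + t + 1 ↔ ¬ μ.toSol (I.n + t) = x + 1) := by
    intro x t hu
    rw [toSol_course_eq_succ hf (hd x) hu, toSol_ta, code_eq_succ]
  intro a ha
  rw [input_zero, input_one] at ha
  refine ⟨?_, fun b hb hab => ?_⟩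
  · by_cases hx : a < I.n
    · exact hcourse ⟨a, hx⟩
    · have := hta ⟨a - I.n, by omega⟩
      rwa [show I.n + (a - I.n) = a by omega] at this
  · rw [input_zero, input_one] at hb
    by_cases hx : a < I.n
    · have hb' : I.n ≤ b := by
        simp only [RAM.Adj, input_zero, hx, if_true] at hab
        exact hab.1
      obtain ⟨t, rfl⟩ := Nat.exists_eq_add_of_le hb'
      exact hedge ⟨a, hx⟩ ⟨t, by omega⟩ ((adj_input ⟨a, hx⟩ ⟨t, by omega⟩).1 hab)
    · have hb' : b < I.n := by
        simp only [RAM.Adj, input_zero, hx, if_false] at hab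
        exact hab.1
      obtain ⟨t, rfl⟩ := Nat.exists_eq_add_of_le (not_lt.1 hx)
      have := hedge ⟨b, hb'⟩ ⟨t, by omega⟩ ((adj_input ⟨b, hb'⟩ ⟨t, by omega⟩).1 hab.symm)
      simp only at this
      tauto

/-! ### From solutions to matchings -/

/-- The matching is read off from what the TAs own. No bound on degrees is needed, because the
condition at a course already ties its degree to its capacity. -/
theorem exists_isMEFE_of_isSol {p : ℕ → ℕ} (hp : RAM.IsSol I.input p) :
    ∃ μ : I.Matching, μ.IsMEFE ∧ ∀ t : Fin I.m, p (I.n + t) = I.code (μ t) := by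
  have hlt : ∀ x : Fin I.n, (x : ℕ) < I.input 0 + I.input 1 := fun x => by simp; omega
  have hlt' : ∀ t : Fin I.m, I.n + (t : ℕ) < I.input 0 + I.input 1 := fun t => by simp
  have hcode : ∀ t : Fin I.m, ∃ o, p (I.n + t) = I.code o := by
    intro t
    have h1 := (hp _ (hlt' t)).1
    simp only [RAM.OK, input_zero, Nat.not_lt.2 (Nat.le_add_right I.n t), if_false] at h1
    have h2 := h1.1
    rw [input_zero] at h2
    rcases h3 : p (I.n + t) with _ | x
    · exact ⟨none, rfl⟩
    · exact ⟨some ⟨x, by omega⟩, rfl⟩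
  obtain ⟨μ, hμ⟩ : ∃ μ : I.Matching, ∀ t : Fin I.m, p (I.n + t) = I.code (μ t) :=
    ⟨_, fun t => (hcode t).choose_spec⟩
  have hta : ∀ t, _ := fun t => (taOK_code t (μ t)).1 (by rw [← hμ t]; exact (hp _ (hlt' t)).1)
  -- Unique ownership: a TA gets `x` exactly when it is a neighbour whose edge is not owned by `x`.
  have hmem : ∀ x t, μ t = some x ↔ I.u t x ≠ 0 ∧ p x ≠ I.n + t + 1 := by
    intro x t
    rw [← code_eq_succ, ← hμ]
    constructor
    · intro h
      have hu := (hta t).1 x (by rw [← code_eq_succ, ← hμ, h])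
      exact ⟨hu, fun hc => ((hp x (hlt x)).2 _ (hlt' t) ((adj_input x t).2 hu)).1 hc h⟩
    · rintro ⟨hu, hne⟩
      by_contra hc
      exact hne (((hp x (hlt x)).2 _ (hlt' t) ((adj_input x t).2 hu)).2 hc)
  have hcourse : ∀ x, (μ.assigned x).card = I.cap x ∧
      I.k.num * I.cap x ≤ I.k.den * ∑ t ∈ μ.assigned x, I.v x t := by
    intro x
    have hok := (hp x (hlt x)).1
    by_cases hc : ∃ t : Fin I.m, p x = I.n + t + 1
    · obtain ⟨t, ht⟩ := hc
      rw [ht, courseOK_succ] at hok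
      have hS : μ.assigned x = (I.nbrs x).erase t := by
        ext t'
        rw [Finset.mem_erase, mem_assigned, hmem, ht, mem_nbrs, and_comm, ne_eq, ne_eq,
          Nat.add_right_cancel_iff, Nat.add_left_cancel_iff, Fin.val_inj, eq_comm]
      rw [hS, Finset.card_erase_of_mem hok.1]
      exact ⟨by omega, hok.2.2⟩
    · have h0 : p x = 0 := by
        by_contra h0
        have hok' := hok
        -- A nonzero code at a course lies between `I.n + 1` and `I.n + I.m`, so it names a TA.
        simp only [RAM.OK, RAM.CourseOK, input_zero, input_one, x.2, if_true, ne_eq, h0,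
          not_false_eq_true] at hok'
        exact hc ⟨⟨p x - 1 - I.n, by omega⟩, by simp only; omega⟩
      rw [h0, courseOK_zero] at hok
      have hS : μ.assigned x = I.nbrs x := by
        ext t'
        rw [mem_assigned, hmem, mem_nbrs, h0]
        simp
      rwa [hS]
  refine ⟨μ, ⟨⟨fun x => (hcourse x).1, fun t x h => (hta t).1 x h⟩,
    fun x => (le_avgUtil_iff μ x).2 (hcourse x).2, ?_⟩, hμ⟩
  rintro t t' ⟨x, hx, hg, hlt⟩
  rcases (hta t).2 x with h | h
  · exact absurd h (not_le.2 hlt)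
  -- The remaining goal `t' ≠ t` holds since nobody strictly prefers its own course to itself.
  · refine (low_input t x).1 h t' ?_ ((hta t').1 x hx) hg
    rintro rfl
    rw [Matching.utility, hx] at hlt
    exact lt_irrefl _ hlt

end Instance

end MEFE

/-! ### Proof of the theorem and the corollary -/

namespace RAM

/-- The program that solves the matching problem; without courses the answer is immediate, and the
number of TAs may be exponential in the length of the input. -/
def matchingProg : Prog :=
  .cond (.load 0 (.const 0)) (Cmd.main.compile 0) (.store 1 (.const 0) (.const 1))

open MEFE.Instance in
theorem runs_matchingProg (I : MEFE.Instance) (hd : ∀ x, (I.nbrs x).card ≤ I.cap x + 1) :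
    Runs matchingProg (initial I.encode) ((Cmd.main.steps + 20).eval (inputLength I.encode))
      fun s => I.CorrectAnswer (s 1) := by
  have h0 : (initial I.encode) 0 = I.input := rfl
  refine Runs.mono (Runs.cond (A := Cmd.main.steps.eval (inputLength I.encode)) (fun hn => ?_)
    fun hn => Runs.store ?_) (by simp [Term.cost]; omega) fun _ => id
  · have hn : 0 < I.n := Nat.pos_of_ne_zero (by simpa [Term.eval, h0] using hn)
    have hrep : Rep I.input (fun _ _ => 0) (fun _ => 0) (initial I.encode) := by
      refine ⟨h0, rfl, fun a => ?_⟩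
      funext j
      simp [initial, a.idx_ne.1]
    refine (Cmd.runs_compile (I.vertices_le hn) I.size_input_le Cmd.main 0 _ _ _ hrep).mono le_rfl
      fun s hs => ?_
    rw [show s 1 = _ from hs.1.mem .out]
    rcases Cmd.main_run (inp := I.input) (M := fun _ _ => 0) (ρ := fun _ => 0)
      (fun _ => rfl) with ⟨h1, p, hp, h2⟩ | ⟨h1, h2⟩
    · obtain ⟨μ, hμ, hc⟩ := exists_isMEFE_of_isSol hp
      exact Or.inl ⟨h1, μ, hμ, fun t => (h2 t t.2).trans (hc t)⟩
    · exact Or.inr ⟨h1, fun ⟨μ, hμ⟩ => h2 ⟨_, hμ.isSol hd⟩⟩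
  · have hn : I.n = 0 := by simpa [Term.eval, h0] using hn
    have : IsEmpty (Fin I.n) := by rw [hn]; infer_instance
    -- Without courses the empty matching is MEFE. Its codes are 0, which the untouched cells of
    -- array `1` already contain.
    refine Or.inl ⟨by simp [State.write, Term.eval], fun _ => none,
      ⟨⟨fun x => isEmptyElim x, by simp⟩, fun x => isEmptyElim x, ?_⟩, fun t => ?_⟩
    · rintro t t' ⟨x, -⟩
      exact isEmptyElim x
    · simp [State.write, Term.eval, initial, MEFE.Instance.code]

theorem solvable_of_degree_le (dom : MEFE.Instance → Prop)
    (h : ∀ I, dom I → ∀ x, I.degree x ≤ I.cap x + 1) :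
    SolvableInPolyTime dom MEFE.Instance.encode MEFE.Instance.CorrectAnswer :=
  ⟨matchingProg, _, fun I hI => runs_matchingProg I (h I hI)⟩

end RAM

theorem theorem4 :
    RAM.SolvableInPolyTime
      (fun I : MEFE.Instance => ∀ x : Fin I.n, (I.degree x : ℤ) - (I.cap x : ℤ) ≤ 1)
      MEFE.Instance.encode MEFE.Instance.CorrectAnswer ∧
    RAM.SolvableInPolyTime
      (fun I : MEFE.Instance => ∀ x : Fin I.n, I.degree x ≤ 2)
      MEFE.Instance.encode MEFE.Instance.CorrectAnswer := by
  refine ⟨RAM.solvable_of_degree_le _ fun I h x => ?_, RAM.solvable_of_degree_le _ fun I h x => ?_⟩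
  · have := h x
    omega
  · have := h x
    -- Capacities are at least 1, so degree at most 2 implies the bound of the theorem.
    have := I.cap_pos x
    omega
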